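/- An ensemble of unitaries on $\mathbb C^D$ is a (Borel) probability measure $\mu$ on $U(D)$; its $k$-fold twirling channel is $\Phi^{(k)}_\mu(A)=\mathbb E_{U\sim\mu}\,U^{\otimes k}A\,(U^{\otimes k})^\dagger$. It is a unitary $k$-design with relative error $\epsilon$ if $(1-\epsilon)\Phi^{(k)}_{\rm Haar}\preceq\Phi^{(k)}_\mu\preceq(1+\epsilon)\Phi^{(k)}_{\rm Haar}$, where $\Phi\preceq\Phi'$ means that $\Phi'-\Phi$ is completely positive. An ensemble of pure states is a state $k$-design with relative error $\epsilon$ if $(1-\epsilon)\rho^{(k)}_{\rm Haar}\preceq\rho^{(k)}\preceq(1+\epsilon)\rho^{(k)}_{\rm Haar}$ in the positive semidefinite order, where $\rho^{(k)}=\mathbb E_\psi\,|\psi\rangle\langle\psi|^{\otimes k}$ and $\rho^{(k)}_{\rm Haar}$ is the corresponding moment of a Haar random state. (i) Let $\mu$ be an ensemble of $N$-qubit unitaries that is a unitary $k$-design with relative error $\epsilon'$, and suppose $k^2\le 2^N$. Then the ensemble of Choi states $(U\otimes I)|\mathrm{EPR}\rangle$, $U\sim\mu$, where $|\mathrm{EPR}\rangle=2^{-N/2}\sum_x|x\rangle|x\rangle$,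 is a state $k$-design (on $2N$ qubits) with relative error $$(1+\epsilon')(1+k^22^{-N})(1+k^22^{-2N})-1 .$$ (ii) Fix $d\ge1$. Consider systems of $N=L^d$ qubits placed on the $d$-dimensional hypercubic lattice of side $L$ (with open or periodic boundary conditions). A local circuit of depth at most $t$ is a product of at most $t$ layers, each layer being a product of arbitrary one-qubit and nearest-neighbour two-qubit unitary gates with pairwise disjoint supports. Let $L_n$, $N_n=L_n^d$, $t_n\in\mathbb N$ and $\epsilon_n>0$ be sequences such that $N_n/\epsilon_n\to\infty$, such that $\epsilon_n$ is at least inverse polynomial in $N_n$ (i.e. $\epsilon_n\ge N_n^{-C}$ for some constant $C$ and all large $n$), and such that $$t_n=o\big((\log(N_n/\epsilon_n))^{1/d}\big)$$ (in particular whenever $t_n=\tilde o((\log(N_n/\epsilon_n))^{1/d})$, where $\tilde o$ leaves room for further logarithmic factors). Then for all sufficiently large $n$ and all $k\ge4$, no ensemble of $N_n$-qubit unitaries of the form $V_1UV_2$, with $V_1,V_2$ Clifford unitaries and $U$ a local circuit of depth at most $t_n$ ($V_1,U,V_2$ being arbitrary, and arbitrarily and possibly jointly distributed), is a unitary $k$-design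 with relative error $\epsilon_n$. -/

import Mathlib

open MeasureTheory Filter Asymptotics
open scoped Kronecker ComplexOrder

noncomputable section

/-! ### The unitary group with its Borel structure and its Haar probability measure -/

section HaarUnitary

variable (n : Type*) [Fintype n] [DecidableEq n]

instance unitaryMeasurableSpace : MeasurableSpace (Matrix.unitaryGroup n ℂ) := borel _

instance unitaryBorelSpace : BorelSpace (Matrix.unitaryGroup n ℂ) := ⟨rfl⟩

instance unitaryCompactSpace : CompactSpace (Matrix.unitaryGroup n ℂ) := by
  rw [← isCompact_univ_iff]
  refine (Topology.IsEmbedding.subtypeVal.isCompact_iff).2 ?_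
  rw [Set.image_univ, Subtype.range_val]
  have hK : IsCompact (Set.univ.pi fun _ : n => Set.univ.pi fun _ : n =>
      Metric.closedBall (0 : ℂ) 1) :=
    isCompact_univ_pi fun _ => isCompact_univ_pi fun _ => isCompact_closedBall 0 1
  refine IsCompact.of_isClosed_subset (s := Set.univ.pi fun _ : n => Set.univ.pi fun _ : n =>
      Metric.closedBall (0 : ℂ) 1) hK ?_ ?_
  · have h1 : IsClosed {A : Matrix n n ℂ | star A * A = 1} :=
      isClosed_eq (by fun_prop) continuous_const
    have h2 : IsClosed {A : Matrix n n ℂ | A * star A = 1} :=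
      isClosed_eq (by fun_prop) continuous_const
    exact h1.inter h2
  · intro A hA i _ j _
    simpa using entry_norm_bound_of_unitary hA i j

/-- The Haar probability measure on the unitary group. -/
def haarUnitary : Measure (Matrix.unitaryGroup n ℂ) := Measure.haarMeasure ⊤

instance haarUnitary_isProbabilityMeasure : IsProbabilityMeasure (haarUnitary n) :=
  ⟨Measure.haarMeasure_self⟩

end HaarUnitary

/-! ### Tensor products, twirling channels, complete positivity, designs -/

section Designs

variable {κ n Ω : Type*}

/-- The tensor product `⨂ i, A i` of a finite family of operators on `ℂ^n`, as an operator on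
`(ℂ^n)^{⊗ κ}`, whose computational basis is indexed by `κ → n`. -/
def tensorProd [Fintype κ] (A : κ → Matrix n n ℂ) : Matrix (κ → n) (κ → n) ℂ :=
  Matrix.of fun x y => ∏ i, A i (x i) (y i)

/-- The tensor power `A^{⊗ k}`. -/
def tensorPow (k : ℕ) (A : Matrix n n ℂ) : Matrix (Fin k → n) (Fin k → n) ℂ :=
  tensorProd fun _ => A

variable [Fintype n] [DecidableEq n]

/-- `U^{⊗ k} A (U^{⊗ k})†`. -/
def conjTensorPow (k : ℕ) (U : Matrix.unitaryGroup n ℂ) (A : Matrix (Fin k → n) (Fin k → n) ℂ) :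
    Matrix (Fin k → n) (Fin k → n) ℂ :=
  tensorPow k (U : Matrix n n ℂ) * A * (tensorPow k (U : Matrix n n ℂ)).conjTranspose

theorem continuous_conjTensorPow (k : ℕ) (A : Matrix (Fin k → n) (Fin k → n) ℂ) :
    Continuous fun U : Matrix.unitaryGroup n ℂ => conjTensorPow k U A := by
  have h : Continuous fun U : Matrix.unitaryGroup n ℂ => tensorPow k (U : Matrix n n ℂ) := by
    refine continuous_matrix fun x y => ?_
    change Continuous fun U : Matrix.unitaryGroup n ℂ => ∏ i, (U : Matrix n n ℂ) (x i) (y i)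
    refine continuous_finsetProd _ fun i _ => ?_
    exact (continuous_subtype_val (p := fun M => M ∈ Matrix.unitaryGroup n ℂ)).matrix_elem _ _
  exact (h.matrix_mul (continuous_const (y := A))).matrix_mul h.matrix_conjTranspose

theorem integrable_conjTensorPow (μ : Measure (Matrix.unitaryGroup n ℂ)) [IsFiniteMeasure μ]
    (k : ℕ) (A : Matrix (Fin k → n) (Fin k → n) ℂ) (x y : Fin k → n) :
    Integrable (fun U => conjTensorPow k U A x y) μ :=
  ((continuous_conjTensorPow k A).matrix_elem x y).integrable_of_hasCompactSupport
    (HasCompactSupport.of_compactSpace _)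

/-- The `k`-fold twirling channel `A ↦ 𝔼_{U ∼ μ} U^{⊗ k} A (U^{⊗ k})†` of an ensemble of unitaries,
i.e. of a probability measure `μ` on the unitary group (the expectation is taken entrywise). -/
def twirl (μ : Measure (Matrix.unitaryGroup n ℂ)) [IsFiniteMeasure μ] (k : ℕ) :
    Matrix (Fin k → n) (Fin k → n) ℂ →ₗ[ℂ] Matrix (Fin k → n) (Fin k → n) ℂ where
  toFun A := Matrix.of fun x y => ∫ U, conjTensorPow k U A x y ∂μ
  map_add' A B := by
    ext x y
    simp only [Matrix.of_apply, Matrix.add_apply]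
    rw [← integral_add (integrable_conjTensorPow μ k A x y) (integrable_conjTensorPow μ k B x y)]
    simp [conjTensorPow, Matrix.mul_add, Matrix.add_mul]
  map_smul' c A := by
    ext x y
    simp only [Matrix.of_apply, Matrix.smul_apply, RingHom.id_apply]
    rw [← integral_smul]
    simp [conjTensorPow]

/-- A linear map `Φ` between matrix algebras is completely positive if `Φ ⊗ id_r` maps positive
semidefinite matrices to positive semidefinite matrices, for every dimension `r`. -/
def IsCompletelyPositive {m : Type*} (Φ : Matrix m m ℂ →ₗ[ℂ] Matrix m m ℂ) : Prop :=
  ∀ (r : ℕ) (M : Matrix (m × Fin r) (m × Fin r) ℂ), M.PosSemidef →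
    (Matrix.of fun p q : m × Fin r =>
      Φ (Matrix.of fun x y : m => M (x, p.2) (y, q.2)) p.1 q.1).PosSemidef

/-- The ensemble `μ` is an approximate unitary `k`-design with relative error `ε`:
`(1 - ε) Φ_Haar ⪯ Φ_μ ⪯ (1 + ε) Φ_Haar`, where `Φ ⪯ Φ'` means that `Φ' - Φ` is completely
positive. -/
def IsRelativeUnitaryDesign (μ : Measure (Matrix.unitaryGroup n ℂ)) [IsFiniteMeasure μ]
    (k : ℕ) (ε : ℝ) : Prop :=
  IsCompletelyPositive (twirl μ k - ((1 - ε : ℝ) : ℂ) • twirl (haarUnitary n) k) ∧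
  IsCompletelyPositive (((1 + ε : ℝ) : ℂ) • twirl (haarUnitary n) k - twirl μ k)

/-- The `k`-th moment `𝔼_{ω ∼ μ} (|ψ_ω⟩⟨ψ_ω|)^{⊗ k}` of an ensemble of pure states, given as a
family of vectors `ψ_ω` with `ω` drawn from `μ`. -/
def stateMoment [MeasurableSpace Ω] (μ : Measure Ω) (ψ : Ω → n → ℂ) (k : ℕ) :
    Matrix (Fin k → n) (Fin k → n) ℂ :=
  Matrix.of fun x y => ∫ ω, tensorPow k (Matrix.vecMulVec (ψ ω) (star (ψ ω))) x y ∂μ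

/-- The `k`-th moment of the Haar random state `U |0⟩`, `U` Haar distributed; the reference vector
`|0⟩` is the basis vector of the default index. -/
def haarStateMoment (n : Type*) [Fintype n] [DecidableEq n] [Inhabited n] (k : ℕ) :
    Matrix (Fin k → n) (Fin k → n) ℂ :=
  stateMoment (haarUnitary n) (fun U => (U : Matrix n n ℂ).mulVec (Pi.single default 1)) k

/-- The ensemble of pure states `ψ_ω`, `ω ∼ μ`, is an approximate state `k`-design with relative
error `ε`: `(1 - ε) ρ_Haar ⪯ ρ ⪯ (1 + ε) ρ_Haar` in the positive semidefinite order. -/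
def IsRelativeStateDesign [Inhabited n] [MeasurableSpace Ω] (μ : Measure Ω) (ψ : Ω → n → ℂ)
    (k : ℕ) (ε : ℝ) : Prop :=
  (stateMoment μ ψ k - ((1 - ε : ℝ) : ℂ) • haarStateMoment n k).PosSemidef ∧
  (((1 + ε : ℝ) : ℂ) • haarStateMoment n k - stateMoment μ ψ k).PosSemidef

/-- The EPR (maximally entangled) state `|n|^{-1/2} ∑ x, |x⟩|x⟩` of two copies of a system. -/
def eprState (n : Type*) [Fintype n] [DecidableEq n] : n × n → ℂ :=
  fun p => if p.1 = p.2 then ((Real.sqrt (Fintype.card n))⁻¹ : ℝ) else 0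

/-- The Choi state `(U ⊗ I) |EPR⟩`. -/
def choiState (U : Matrix.unitaryGroup n ℂ) : n × n → ℂ :=
  ((U : Matrix n n ℂ) ⊗ₖ (1 : Matrix n n ℂ)).mulVec (eprState n)

end Designs

/-! ### Pauli and Clifford unitaries

The qubits are labelled by a finite type `ι`; the computational basis is `ι → Fin 2`. -/

section Clifford

variable {ι : Type*} [Fintype ι]

/-- The Pauli string `Z^u X^v = ⨂ i, Z^{u i} X^{v i}`. -/
def pauliString (u v : ι → Fin 2) : Matrix (ι → Fin 2) (ι → Fin 2) ℂ :=
  tensorProd fun i => !![1, 0; 0, -1] ^ (u i : ℕ) * !![0, 1; 1, 0] ^ (v i : ℕ)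

/-- Membership in the Pauli group `{c Z^u X^v : c ∈ {1, i, -1, -i}}`. -/
def IsPauli (P : Matrix (ι → Fin 2) (ι → Fin 2) ℂ) : Prop :=
  ∃ (c : ℂ) (u v : ι → Fin 2), c ^ 4 = 1 ∧ P = c • pauliString u v

variable [DecidableEq ι]

/-- `V` is Clifford: conjugation by `V` maps the Pauli group to itself. -/
def IsClifford (V : Matrix.unitaryGroup (ι → Fin 2) ℂ) : Prop :=
  ∀ P : Matrix (ι → Fin 2) (ι → Fin 2) ℂ, IsPauli P →
    IsPauli ((V : Matrix (ι → Fin 2) (ι → Fin 2) ℂ) * P *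
      (V : Matrix (ι → Fin 2) (ι → Fin 2) ℂ).conjTranspose)

/-- `G` acts only on the qubits in `S`: it is `g ⊗ I` for some operator `g` on the qubits
in `S`. -/
def ActsOn (S : Finset ι) (G : Matrix.unitaryGroup (ι → Fin 2) ℂ) : Prop :=
  ∃ g : Matrix (S → Fin 2) (S → Fin 2) ℂ, ∀ x y : ι → Fin 2,
    (G : Matrix (ι → Fin 2) (ι → Fin 2) ℂ) x y =
      if ∀ i, i ∉ S → x i = y i then g (fun i => x i) (fun i => y i) else 0

end Clifford

/-! ### Local circuits on the `d`-dimensional lattice of linear size `L` -/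

section Circuits

variable {d L : ℕ}

/-- `y` is the successor of `x` in one of the `d` lattice directions. Coordinates are taken
modulo `L`: circuits with open boundary conditions are those that do not use the wrap-around. -/
def IsSucc (x y : Fin d → Fin L) : Prop :=
  ∃ i, (y i : ℕ) = ((x i : ℕ) + 1) % L ∧ ∀ j, j ≠ i → y j = x j

/-- The admissible supports of gates: one site, or two neighbouring sites. -/
def IsGateSupport (S : Finset (Fin d → Fin L)) : Prop :=
  (∃ x, S = {x}) ∨ ∃ x y, IsSucc x y ∧ S = {x, y}

/-- One layer: a product of arbitrary one-site and nearest-neighbour two-site unitary gates with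
pairwise disjoint supports. -/
def IsLayer (W : Matrix.unitaryGroup ((Fin d → Fin L) → Fin 2) ℂ) : Prop :=
  ∃ (m : ℕ) (S : Fin m → Finset (Fin d → Fin L))
    (G : Fin m → Matrix.unitaryGroup ((Fin d → Fin L) → Fin 2) ℂ),
    (∀ a, IsGateSupport (S a)) ∧ (∀ a b, a ≠ b → Disjoint (S a) (S b)) ∧
    (∀ a, ActsOn (S a) (G a)) ∧ W = (List.ofFn G).prod

/-- `U` is a local circuit of depth at most `t`: a product of `t` layers (a layer may be empty). -/
def IsLocalCircuit (t : ℕ) (U : Matrix.unitaryGroup ((Fin d → Fin L) → Fin 2) ℂ) : Prop :=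
  ∃ W : Fin t → Matrix.unitaryGroup ((Fin d → Fin L) → Fin 2) ℂ,
    (∀ a, IsLayer (W a)) ∧ U = (List.ofFn W).prod

/-- `W` is a Clifford-sandwiched local circuit `V₁ U V₂`, with `V₁`, `V₂` Clifford and `U` a local
circuit of depth at most `t`. -/
def IsCliffordSandwich (t : ℕ) (W : Matrix.unitaryGroup ((Fin d → Fin L) → Fin 2) ℂ) : Prop :=
  ∃ V₁ U V₂ : Matrix.unitaryGroup ((Fin d → Fin L) → Fin 2) ℂ,
    IsClifford V₁ ∧ IsClifford V₂ ∧ IsLocalCircuit t U ∧ W = V₁ * U * V₂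

end Circuits

end

noncomputable section

set_option linter.unusedSectionVars false

/-! ### Tensor products and permutation operators -/

section TensorAlgebra

variable {κ n : Type*} [Fintype κ]

/-! Both halves rest on one identity, which replaces Weingarten calculus. Let `D` be the dimension.
If `B` commutes with every `U^{⊗k}`, then `(∑ π, tr(π) π) B = ∑ π, tr(B π⁻¹) π`
(`traceWeighted_mul`). For a Haar twirl `B = Φ(A)`, the traces on the right can be computed from
`A`. The operator on the left factors as a product of terms `D + J_i` with `J_i` a Jucys–Murphy
element, a sum of `i` transpositions. Hence its spectrum lies between `∏ (D - i)` and `∏ (D + i)` in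
every unitary representation (`spectrumBetween_traceWeighted`).

Choi states. Applied to matrix units, the identity says that `∑ π, tr(π) π`, acting on the first
halves, sends the Choi matrix of the Haar twirl to the symmetrizer of `ℂ^D ⊗ ℂ^D`. Up to a scalar,
this symmetrizer is the Haar state moment in dimension `D²`. The spectral bounds therefore compare
the two Haar moments (`haar_choiState_bounds`). Complete positivity transfers the unitary design
condition to Choi matrices, at the cost of the factor `1 + ε`.

No-go. Let `A = ∑ P, P^{⊗4} ⊗ I^{⊗(k-4)}` over Pauli strings. It is a positive multiple of a
projection and is fixed by Clifford conjugation. The quantity `tr(A U^{⊗k} A U^{⊗k}†)` is `D^{k-4} ∑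
|tr(P U Q U†)|⁴`, so this fourth moment ignores Clifford factors on either side. For a Haar random
`U` its mean is at most `96 D⁴`. For a circuit of depth `t`, each `Q = Z_x` evolves to an operator
supported on at most `(2t+1)^d` sites. Parseval and Cauchy–Schwarz then make its contribution at
least `D⁴ / 4^{(2t+1)^d}`. Summing over the `N` sites and testing the design condition on `A` gives
`N ≤ 96 (1 + ε) 4^{(2t+1)^d}`, which fails eventually at the assumed depth. -/

theorem tensorProd_apply (A : κ → Matrix n n ℂ) (x y : κ → n) :
    tensorProd A x y = ∏ i, A i (x i) (y i) := rfl

theorem tensorProd_conjTranspose (A : κ → Matrix n n ℂ) :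
    (tensorProd A).conjTranspose = tensorProd fun i => (A i).conjTranspose := by
  ext x y
  simp [tensorProd_apply, Matrix.conjTranspose_apply]

theorem tensorProd_smul (c : κ → ℂ) (A : κ → Matrix n n ℂ) :
    tensorProd (fun i => c i • A i) = (∏ i, c i) • tensorProd A := by
  ext x y
  simp [tensorProd_apply, Finset.prod_mul_distrib]

variable [DecidableEq κ] [Fintype n]

theorem tensorProd_mul (A B : κ → Matrix n n ℂ) :
    tensorProd A * tensorProd B = tensorProd fun i => A i * B i := by
  ext x y
  simp only [Matrix.mul_apply, tensorProd_apply, Fintype.prod_sum, Finset.prod_mul_distrib]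

theorem trace_tensorProd (A : κ → Matrix n n ℂ) :
    (tensorProd A).trace = ∏ i, (A i).trace := by
  simp only [Matrix.trace, Matrix.diag_apply, tensorProd_apply, Fintype.prod_sum]

/-- Multilinear expansion of a tensor product of sums. -/
theorem tensorProd_sum {J : Type*} [Fintype J] (A : κ → J → Matrix n n ℂ) :
    tensorProd (fun i => ∑ j, A i j) = ∑ f : κ → J, tensorProd fun i => A i (f i) := by
  ext x y
  simp only [tensorProd_apply, Matrix.sum_apply, Fintype.prod_sum]

theorem tensorPow_mul (k : ℕ) (A B : Matrix n n ℂ) :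
    tensorPow k A * tensorPow k B = tensorPow k (A * B) :=
  tensorProd_mul _ _

theorem tensorPow_conjTranspose (k : ℕ) (A : Matrix n n ℂ) :
    (tensorPow k A).conjTranspose = tensorPow k A.conjTranspose :=
  tensorProd_conjTranspose _

variable [DecidableEq n]

theorem tensorProd_one : tensorProd (fun _ : κ => (1 : Matrix n n ℂ)) = 1 := by
  ext x y
  simp only [tensorProd_apply, Matrix.one_apply, Finset.prod_ite_zero, Finset.prod_const_one,
    Finset.mem_univ, true_imp_iff, funext_iff]

theorem tensorProd_single (a b : κ → n) :
    tensorProd (fun i => Matrix.single (a i) (b i) (1 : ℂ)) = Matrix.single a b 1 := by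
  ext x y
  simp only [tensorProd_apply, Matrix.single_apply, Finset.prod_ite_zero, Finset.prod_const_one,
    Finset.mem_univ, true_imp_iff, funext_iff, forall_and]

theorem tensorPow_one (k : ℕ) : tensorPow k (1 : Matrix n n ℂ) = 1 := tensorProd_one

theorem tensorPow_unitary_conjTranspose_mul (k : ℕ) (U : Matrix.unitaryGroup n ℂ) :
    (tensorPow k (U : Matrix n n ℂ)).conjTranspose * tensorPow k (U : Matrix n n ℂ) = 1 := by
  rw [tensorPow_conjTranspose, tensorPow_mul, ← Matrix.star_eq_conjTranspose,
    Matrix.mem_unitaryGroup_iff'.1 U.2, tensorPow_one]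

end TensorAlgebra

/-! ### Permutations of the tensor factors -/

section PermMat

variable {k : ℕ} {n : Type*} [Fintype n] [DecidableEq n]

/-- The operator permuting the `k` tensor factors of `(ℂ^n)^{⊗ k}`. -/
def permMat (n : Type*) [Fintype n] [DecidableEq n] {k : ℕ} :
    Equiv.Perm (Fin k) →* Matrix (Fin k → n) (Fin k → n) ℂ where
  toFun π := Matrix.of fun x y => if x ∘ π = y then 1 else 0
  map_one' := by
    ext x y
    simp [Matrix.one_apply]
  map_mul' π σ := by
    ext x y
    rw [Matrix.mul_apply, Finset.sum_eq_single (x ∘ π)]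
    · simp [Function.comp_assoc]
      congr
    · intro z _ hz
      simp [hz.symm]
    · simp

theorem permMat_apply (π : Equiv.Perm (Fin k)) (x y : Fin k → n) :
    permMat n π x y = if x ∘ π = y then 1 else 0 := rfl

theorem comp_perm_eq_iff (π : Equiv.Perm (Fin k)) (x y : Fin k → n) :
    x ∘ π = y ↔ x = y ∘ ⇑(π⁻¹) := by
  constructor
  · rintro rfl
    ext i; simp
  · rintro rfl
    ext i; simp

theorem permMat_conjTranspose (π : Equiv.Perm (Fin k)) :
    (permMat n π).conjTranspose = permMat n π⁻¹ := by
  ext x y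
  simp only [Matrix.conjTranspose_apply, permMat_apply, comp_perm_eq_iff π y x, eq_comm (a := y)]
  split_ifs <;> simp

theorem permMat_mul_apply (π : Equiv.Perm (Fin k)) (A : Matrix (Fin k → n) (Fin k → n) ℂ)
    (x y : Fin k → n) : (permMat n π * A) x y = A (x ∘ π) y := by
  simp [Matrix.mul_apply, permMat_apply]

theorem mul_permMat_inv_apply (π : Equiv.Perm (Fin k)) (A : Matrix (Fin k → n) (Fin k → n) ℂ)
    (x y : Fin k → n) : (A * permMat n π⁻¹) x y = A x (y ∘ π) := by
  simp [Matrix.mul_apply, permMat_apply, comp_perm_eq_iff]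

theorem tensorPow_comp_perm (π : Equiv.Perm (Fin k)) (A : Matrix n n ℂ) (x y : Fin k → n) :
    tensorPow k A (x ∘ π) (y ∘ π) = tensorPow k A x y :=
  Equiv.prod_comp π fun i => A (x i) (y i)

theorem permMat_commute_tensorPow (π : Equiv.Perm (Fin k)) (A : Matrix n n ℂ) :
    Commute (permMat n π) (tensorPow k A) := by
  have h : permMat n π * tensorPow k A * permMat n π⁻¹ = tensorPow k A := by
    ext x y
    rw [mul_permMat_inv_apply, permMat_mul_apply, tensorPow_comp_perm]
  calc permMat n π * tensorPow k A
      = permMat n π * tensorPow k A * (permMat n π⁻¹ * permMat n π) := by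
        rw [← map_mul]; simp
    _ = tensorPow k A * permMat n π := by rw [← mul_assoc, h]

end PermMat

/-! ### The commutant of the unitary tensor powers -/

section Commutant

variable {k : ℕ} {n : Type*} [Fintype n] [DecidableEq n]

theorem infinite_unitCircle : {z : ℂ | star z * z = 1}.Infinite := by
  have h : (Set.Icc (0 : ℝ) 1).Infinite := Set.Icc_infinite zero_lt_one
  have hinj : Set.InjOn (fun θ : ℝ => (Circle.exp θ : ℂ)) (Set.Icc 0 1) := fun a ha b hb hab =>
    Circle.exp_injOn_Icc (by linarith [Real.pi_gt_three]) ha hb (Circle.coe_injective hab)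
  refine (h.image hinj).mono ?_
  rintro _ ⟨θ, -, rfl⟩
  have := Circle.normSq_coe (Circle.exp θ)
  rw [Set.mem_ofPred_eq, mul_comm]
  exact (Complex.mul_conj _).trans (by rw [this, Complex.ofReal_one])

/-- A polynomial identity with homogeneous terms that holds on a box with infinite sides holds
everywhere. -/
theorem sum_prod_eq_zero_of_infinite {J : Type*} [Fintype J] {F : Type*} [Fintype F]
    (f : F → Fin k → J) (c : F → ℂ) {s : Set ℂ} (hs : s.Infinite)
    (h : ∀ z : J → ℂ, (∀ j, z j ∈ s) → ∑ g, c g * ∏ i, z (f g i) = 0) :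
    (∑ g, MvPolynomial.C (c g) * ∏ i, MvPolynomial.X (f g i) : MvPolynomial J ℂ) = 0 := by
  refine MvPolynomial.funext_set (fun _ => s) (fun _ => hs) fun z hz => ?_
  simpa [map_sum, map_prod] using h z fun j => hz j (Set.mem_univ j)

theorem sum_prod_eq_zero_of_infinite' {J : Type*} [Fintype J] {F : Type*} [Fintype F]
    (f : F → Fin k → J) (c : F → ℂ) {s : Set ℂ} (hs : s.Infinite)
    (h : ∀ z : J → ℂ, (∀ j, z j ∈ s) → ∑ g, c g * ∏ i, z (f g i) = 0) (z : J → ℂ) :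
    ∑ g, c g * ∏ i, z (f g i) = 0 := by
  simpa [map_sum, map_prod] using
    congrArg (MvPolynomial.eval z) (sum_prod_eq_zero_of_infinite f c hs h)

theorem tensorPow_diagonal (z : n → ℂ) :
    tensorPow k (Matrix.diagonal z) = Matrix.diagonal fun x => ∏ i, z (x i) := by
  ext x y
  by_cases h : x = y
  · subst h; simp [tensorPow, tensorProd_apply]
  · obtain ⟨i, hi⟩ := Function.ne_iff.1 h
    rw [Matrix.diagonal_apply_ne _ h]
    exact Finset.prod_eq_zero (Finset.mem_univ i) (Matrix.diagonal_apply_ne _ hi)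

/-- Entry `(x, y)` of the commutator is `B x y (∏ z (y i) - ∏ z (x i))`, a polynomial in the
diagonal entries. It vanishes on the torus of unitary diagonal matrices, hence identically. -/
theorem commute_tensorPow_diagonal {B : Matrix (Fin k → n) (Fin k → n) ℂ}
    (hB : ∀ U : Matrix.unitaryGroup n ℂ, Commute B (tensorPow k (U : Matrix n n ℂ)))
    (z : n → ℂ) : Commute B (tensorPow k (Matrix.diagonal z)) := by
  ext x y
  have key := sum_prod_eq_zero_of_infinite' (F := Bool) (fun b => if b then y else x)
    (fun b => if b then B x y else - B x y) infinite_unitCircle (fun w hw => ?_) z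
  · simp only [Fintype.sum_bool] at key
    rw [tensorPow_diagonal, Matrix.mul_diagonal, Matrix.diagonal_mul]
    simp at key
    linear_combination key
  · have hU : Matrix.diagonal w ∈ Matrix.unitaryGroup n ℂ := by
      rw [Matrix.mem_unitaryGroup_iff', Matrix.star_eq_conjTranspose,
        Matrix.diagonal_conjTranspose, Matrix.diagonal_mul_diagonal, ← Matrix.diagonal_one]
      congr 1
      ext i
      exact hw i
    have := congrFun (congrFun (hB ⟨_, hU⟩).eq x) y
    simp only [tensorPow_diagonal, Matrix.mul_diagonal, Matrix.diagonal_mul] at this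
    simp only [Fintype.sum_bool]
    simp
    linear_combination this

theorem commute_tensorPow_isHermitian {B : Matrix (Fin k → n) (Fin k → n) ℂ}
    (hB : ∀ U : Matrix.unitaryGroup n ℂ, Commute B (tensorPow k (U : Matrix n n ℂ)))
    {H : Matrix n n ℂ} (hH : H.IsHermitian) : Commute B (tensorPow k H) := by
  have h := hH.spectral_theorem
  rw [Unitary.conjStarAlgAut_apply] at h
  rw [h, ← tensorPow_mul, ← tensorPow_mul]
  refine ((hB _).mul_right (commute_tensorPow_diagonal hB _)).mul_right ?_
  exact hB (star hH.eigenvectorUnitary)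

theorem tensorPow_sum_smul {J : Type*} [Fintype J] (z : J → ℂ) (H : J → Matrix n n ℂ) :
    tensorPow k (∑ j, z j • H j) =
      ∑ f : Fin k → J, (∏ i, z (f i)) • tensorProd fun i => H (f i) := by
  rw [tensorPow, tensorProd_sum]
  exact Finset.sum_congr rfl fun f _ => tensorProd_smul _ _

/-- This turns commutation into the vanishing of polynomials in the coefficients `z`, so that it can
be extended from real to complex `z` and then polarized. -/
theorem commute_tensorPow_sum_iff {J : Type*} [Fintype J] (z : J → ℂ) (H : J → Matrix n n ℂ)
    (B : Matrix (Fin k → n) (Fin k → n) ℂ) :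
    Commute B (tensorPow k (∑ j, z j • H j)) ↔ ∀ x y, ∑ f : Fin k → J,
      (B * tensorProd (fun i => H (f i)) - tensorProd (fun i => H (f i)) * B) x y *
        ∏ i, z (f i) = 0 := by
  rw [commute_iff_eq, ← sub_eq_zero, tensorPow_sum_smul, Finset.mul_sum, Finset.sum_mul,
    ← Finset.sum_sub_distrib, ← Matrix.ext_iff]
  simp only [Matrix.mul_smul, Matrix.smul_mul, ← smul_sub, Matrix.sum_apply, Matrix.smul_apply,
    smul_eq_mul, Matrix.zero_apply, mul_comm]

/-- An operator commuting with all `U^{⊗ k}`, `U` unitary, commutes with all `X^{⊗ k}`. -/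
theorem commute_tensorPow {B : Matrix (Fin k → n) (Fin k → n) ℂ}
    (hB : ∀ U : Matrix.unitaryGroup n ℂ, Commute B (tensorPow k (U : Matrix n n ℂ)))
    (X : Matrix n n ℂ) : Commute B (tensorPow k X) := by
  -- Write `X = H₀ + i H₁` with Hermitian parts. Commutation holds for all real combinations of `H₀`
  -- and `H₁`, which are Hermitian, and so by polynomial continuation at the coefficients `(1, i)`.
  obtain ⟨H, hH, hX⟩ : ∃ H : Bool → Matrix n n ℂ, (∀ b, (H b).IsHermitian) ∧
      X = ∑ b, (if b then Complex.I else 1) • H b := by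
    refine ⟨fun b => if b then (-(Complex.I / 2)) • (X - X.conjTranspose)
      else (1 / 2 : ℂ) • (X + X.conjTranspose), ?_, ?_⟩
    · rintro (_ | _) <;> ext x y <;> simp <;> ring
    · ext x y
      simp
      linear_combination (1 / 2 * (X x y - starRingEnd ℂ (X y x))) * Complex.I_sq
  rw [hX, commute_tensorPow_sum_iff]
  intro x y
  have hR : (Set.range Complex.ofReal).Infinite :=
    Set.infinite_range_of_injective Complex.ofReal_injective
  refine sum_prod_eq_zero_of_infinite' (J := Bool) (fun f : Fin k → Bool => f)
    (fun f => (B * tensorProd (fun i => H (f i)) - tensorProd (fun i => H (f i)) * B) x y)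
    hR (fun z hz => ?_) (fun b => if b then Complex.I else 1)
  have hH' : (∑ b, z b • H b).IsHermitian := ?_
  · exact (commute_tensorPow_sum_iff z H B).1 (commute_tensorPow_isHermitian hB hH') x y
  rw [Matrix.IsHermitian, Matrix.conjTranspose_sum]
  refine Finset.sum_congr rfl fun j _ => ?_
  obtain ⟨r, hr⟩ := hz j
  rw [← hr, Matrix.conjTranspose_smul, (hH j).eq]
  simp

/-- This identifies the terms contributing to the multilinear coefficient of `X_0 ⋯ X_{k-1}` in the
polarization below: exactly those indexed by permutations. -/
theorem sum_single_eq_iff_bijective (f : Fin k → Fin k) :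
    (∑ i, Finsupp.single (f i) 1 : Fin k →₀ ℕ) = ∑ i, Finsupp.single i 1 ↔ f.Bijective := by
  constructor
  · intro h
    refine Finite.surjective_iff_bijective.1 fun j => ?_
    by_contra hj
    push Not at hj
    have := DFunLike.congr_fun h j
    simp [Finsupp.finsetSum_apply, Finsupp.single_apply, hj] at this
  · intro h
    exact Equiv.sum_comp (Equiv.ofBijective f h) fun i => Finsupp.single i 1

/-- Polarization of `commute_tensorPow`. -/
theorem commute_sum_tensorProd {B : Matrix (Fin k → n) (Fin k → n) ℂ}
    (hB : ∀ U : Matrix.unitaryGroup n ℂ, Commute B (tensorPow k (U : Matrix n n ℂ)))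
    (X : Fin k → Matrix n n ℂ) :
    Commute B (∑ π : Equiv.Perm (Fin k), tensorProd fun i => X (π i)) := by
  rw [commute_iff_eq, ← sub_eq_zero, Finset.mul_sum, Finset.sum_mul, ← Finset.sum_sub_distrib]
  ext x y
  have h := sum_prod_eq_zero_of_infinite (fun f : Fin k → Fin k => f)
    (fun f => (B * tensorProd (fun i => X (f i)) - tensorProd (fun i => X (f i)) * B) x y)
    Set.infinite_univ
    fun z _ => (commute_tensorPow_sum_iff z X B).1 (commute_tensorPow hB _) x y
  have h2 := congrArg (MvPolynomial.coeff (∑ i, Finsupp.single i 1)) h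
  have hm : ∀ f : Fin k → Fin k, (∏ i, MvPolynomial.X (f i) : MvPolynomial (Fin k) ℂ) =
      MvPolynomial.monomial (∑ i, Finsupp.single (f i) 1) 1 := fun f => by
    rw [MvPolynomial.monomial_sum_one]; rfl
  simp only [hm, MvPolynomial.coeff_sum, MvPolynomial.coeff_C_mul, MvPolynomial.coeff_monomial,
    sum_single_eq_iff_bijective, mul_ite, mul_one, mul_zero, MvPolynomial.coeff_zero] at h2
  rw [← Finset.sum_filter] at h2
  rw [Matrix.zero_apply, ← h2, Matrix.sum_apply]
  refine Finset.sum_bij (fun π _ => ⇑π) (fun π _ => Finset.mem_filter.2 ⟨Finset.mem_univ _, π.bijective⟩)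
    (fun π _ σ _ h => DFunLike.coe_injective h)
    (fun f hf => ⟨Equiv.ofBijective f (Finset.mem_filter.1 hf).2, Finset.mem_univ _, rfl⟩)
    fun π _ => rfl

/-- The number of computational basis states fixed by a permutation of the tensor factors. -/
def fixedCount (n : Type*) [Fintype n] [DecidableEq n] (π : Equiv.Perm (Fin k)) : ℕ :=
  Fintype.card {z : Fin k → n // z ∘ π = z}

/-- The operator `∑ π, tr(π) π`. -/
def traceWeighted {m : Type*} [Fintype m] [DecidableEq m] (n : Type*) [Fintype n] [DecidableEq n]
    (ρ : Equiv.Perm (Fin k) →* Matrix m m ℂ) : Matrix m m ℂ :=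
  ∑ π, (fixedCount n π : ℂ) • ρ π

theorem trace_mul_permMat_inv (B : Matrix (Fin k → n) (Fin k → n) ℂ) (π : Equiv.Perm (Fin k)) :
    (B * permMat n π⁻¹).trace = ∑ a, B a (a ∘ π) := by
  simp [Matrix.trace, mul_permMat_inv_apply]

/-- For `B` in the commutant of the tensor powers, `∑ π, tr(π) π B = ∑ π, tr(B π⁻¹) π`. -/
theorem traceWeighted_mul {B : Matrix (Fin k → n) (Fin k → n) ℂ}
    (hB : ∀ U : Matrix.unitaryGroup n ℂ, Commute B (tensorPow k (U : Matrix n n ℂ))) :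
    traceWeighted n (permMat n) * B =
      ∑ π, (B * permMat n π⁻¹).trace • permMat n π := by
  ext b e
  -- Polarized commutation with the matrix units `|a i⟩⟨b i|`, read at entry `(a, e)`. Summing over
  -- `a` turns the left side into traces against permutations and the right side into fixed-point
  -- counts.
  have key : ∀ a : Fin k → n, ∑ π : Equiv.Perm (Fin k), B a (a ∘ π) * permMat n π b e =
      ∑ π : Equiv.Perm (Fin k), (if a ∘ π = a then 1 else 0) * B (b ∘ π) e := by
    intro a
    have h := congrFun (congrFun
      (commute_sum_tensorProd hB fun i => Matrix.single (a i) (b i) 1).eq a) e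
    have hs : ∀ π : Equiv.Perm (Fin k),
        (tensorProd fun i => Matrix.single (a (π i)) (b (π i)) (1 : ℂ)) =
          Matrix.single (a ∘ π) (b ∘ π) 1 := fun π => tensorProd_single (a ∘ π) (b ∘ π)
    simp only [hs, Finset.mul_sum, Finset.sum_mul, Matrix.sum_apply] at h
    convert h using 2 with π _ π _
    · rw [Matrix.mul_apply, Finset.sum_eq_single (a ∘ π)]
      · simp [Matrix.single_apply, permMat_apply]
      · intro c _ hc
        simp [hc.symm]
      · simp
    · rw [Matrix.mul_apply, Finset.sum_eq_single (b ∘ π)]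
      · simp [Matrix.single_apply]
      · intro c _ hc
        simp [hc.symm]
      · simp
  have h := Finset.sum_congr (rfl : (Finset.univ : Finset (Fin k → n)) = Finset.univ)
    fun a _ => key a
  rw [Finset.sum_comm, Finset.sum_comm (γ := Fin k → n)] at h
  simp only [traceWeighted, Finset.sum_mul, Matrix.sum_apply, Matrix.smul_mul, Matrix.smul_apply,
    permMat_mul_apply, trace_mul_permMat_inv, smul_eq_mul]
  refine Eq.trans (Finset.sum_congr rfl fun π _ => ?_) h.symm
  rw [← Finset.sum_mul, fixedCount, Fintype.card_subtype, Finset.sum_boole]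

end Commutant

/-! ### Spectral bounds in representations of the symmetric group -/

section JucysMurphy

variable {m n : Type*} [Fintype m] [DecidableEq m] [Fintype n] [DecidableEq n]

open scoped MatrixOrder in
theorem Matrix.PosSemidef.mul_of_commute {A B : Matrix m m ℂ}
    (hA : A.PosSemidef) (hB : B.PosSemidef) (h : Commute A B) : (A * B).PosSemidef :=
  Matrix.nonneg_iff_posSemidef.1 (Commute.mul_nonneg (Matrix.nonneg_iff_posSemidef.2 hA)
    (Matrix.nonneg_iff_posSemidef.2 hB) h)

theorem Matrix.PosSemidef.smul_real {A : Matrix m m ℂ} (hA : A.PosSemidef) {r : ℝ} (hr : 0 ≤ r) :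
    ((r : ℂ) • A).PosSemidef :=
  hA.smul (by exact_mod_cast hr)

theorem Matrix.PosSemidef.smul_one {r : ℝ} (hr : 0 ≤ r) :
    ((r : ℂ) • (1 : Matrix m m ℂ)).PosSemidef :=
  Matrix.PosSemidef.one.smul_real hr

/-- All commutation needed for the spectral estimates comes from here: the relevant products are
sums over the symmetric group that are visibly Hermitian. -/
theorem Matrix.IsHermitian.commute_of_mul {A B : Matrix m m ℂ} (hA : A.IsHermitian)
    (hB : B.IsHermitian) (h : (A * B).IsHermitian) : Commute A B := by
  rw [commute_iff_eq, ← h.eq, Matrix.conjTranspose_mul, hA.eq, hB.eq]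

/-- The operator interval `a ≤ A ≤ b` for Hermitian matrices. -/
def SpectrumBetween (a b : ℝ) (A : Matrix m m ℂ) : Prop :=
  (A - (a : ℂ) • 1).PosSemidef ∧ ((b : ℂ) • 1 - A).PosSemidef

theorem SpectrumBetween.posSemidef {a b : ℝ} {A : Matrix m m ℂ} (h : SpectrumBetween a b A)
    (ha : 0 ≤ a) : A.PosSemidef := by
  simpa using h.1.add (Matrix.PosSemidef.smul_one (m := m) ha)

/-- Use `AB - ac = (A - a)B + a(B - c)` and `bd - AB = (b - A)B + b(d - B)`; products of commuting
positive operators are positive. -/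
theorem SpectrumBetween.mul {a b c d : ℝ} {A B : Matrix m m ℂ} (hA : SpectrumBetween a b A)
    (hB : SpectrumBetween c d B) (ha : 0 ≤ a) (hc : 0 ≤ c) (hb : 0 ≤ b) (h : Commute A B) :
    SpectrumBetween (a * c) (b * d) (A * B) := by
  constructor
  · have h1 := (hA.1.mul_of_commute (hB.posSemidef hc)
      (h.sub_left ((Commute.one_left B).smul_left _))).add (hB.1.smul_real ha)
    convert h1 using 1
    simp only [Matrix.sub_mul, Matrix.smul_mul, one_mul, smul_sub, smul_smul, Complex.ofReal_mul]
    abel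
  · have h1 := (hA.2.mul_of_commute (hB.posSemidef hc)
      (((Commute.one_left B).smul_left _).sub_left h)).add (hB.2.smul_real hb)
    convert h1 using 1
    simp only [Matrix.sub_mul, Matrix.smul_mul, one_mul, smul_sub, smul_smul, Complex.ofReal_mul]
    abel

/-- The embedding `S_k → S_{k+1}` as the stabilizer of `0`. -/
def liftPerm (k : ℕ) : Equiv.Perm (Fin k) →* Equiv.Perm (Fin (k + 1)) where
  toFun e := Equiv.Perm.decomposeFin.symm (0, e)
  map_one' := by
    simp
    rfl
  map_mul' e f := by
    ext i
    refine Fin.cases ?_ (fun j => ?_) i <;> simp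

theorem liftPerm_zero {k : ℕ} (e : Equiv.Perm (Fin k)) : liftPerm k e 0 = 0 := by
  simp [liftPerm]

theorem liftPerm_succ {k : ℕ} (e : Equiv.Perm (Fin k)) (i : Fin k) :
    liftPerm k e i.succ = (e i).succ := by
  simp [liftPerm]

theorem decomposeFin_symm_eq_mul {k : ℕ} (p : Fin (k + 1)) (e : Equiv.Perm (Fin k)) :
    Equiv.Perm.decomposeFin.symm (p, e) = Equiv.swap 0 p * liftPerm k e := by
  ext i
  refine Fin.cases ?_ (fun j => ?_) i <;> simp [liftPerm_zero, liftPerm_succ]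

theorem comp_liftPerm_eq_iff {k : ℕ} (e : Equiv.Perm (Fin k)) (z : Fin (k + 1) → n) :
    z ∘ liftPerm k e = z ↔ Fin.tail z ∘ e = Fin.tail z := by
  simp only [funext_iff, Function.comp_apply, Fin.forall_fin_succ, liftPerm_zero, liftPerm_succ,
    Fin.tail, true_and]

theorem fixedCount_liftPerm {k : ℕ} (e : Equiv.Perm (Fin k)) :
    fixedCount n (liftPerm k e) = Fintype.card n * fixedCount n e := by
  rw [fixedCount, fixedCount, ← Fintype.card_prod]
  refine Fintype.card_congr
    { toFun := fun z => (z.1 0, ⟨Fin.tail z.1, (comp_liftPerm_eq_iff e z.1).1 z.2⟩)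
      invFun := fun w => ⟨Fin.cons w.1 w.2.1, (comp_liftPerm_eq_iff e _).2 (by
        rw [Fin.tail_cons]; exact w.2.2)⟩
      left_inv := fun z => Subtype.ext (Fin.cons_self_tail z.1)
      right_inv := fun w => by simp }

theorem comp_swap_mul_liftPerm_eq_iff {k : ℕ} (q : Fin k) (e : Equiv.Perm (Fin k))
    (z : Fin (k + 1) → n) :
    z ∘ (Equiv.swap 0 q.succ * liftPerm k e : Equiv.Perm (Fin (k + 1))) = z ↔
      z 0 = Fin.tail z q ∧ Fin.tail z ∘ e = Fin.tail z := by
  have hsw : z 0 = Fin.tail z q → z ∘ Equiv.swap 0 q.succ = z := by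
    intro h
    ext i
    rcases eq_or_ne i 0 with rfl | h0
    · simpa [Fin.tail] using h.symm
    rcases eq_or_ne i q.succ with rfl | hq
    · simpa [Fin.tail] using h
    · simp [Equiv.swap_apply_of_ne_of_ne h0 hq]
  rw [← comp_liftPerm_eq_iff, Equiv.Perm.coe_mul, ← Function.comp_assoc]
  constructor
  · intro h
    have h0 : z 0 = Fin.tail z q := by
      have := congrFun h 0
      simpa [liftPerm_zero, Fin.tail] using this.symm
    exact ⟨h0, by rwa [hsw h0] at h⟩
  · rintro ⟨h0, h⟩
    rw [hsw h0, h]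

/-- The transposition splices `0` into the cycle of `q`, so the number of cycles does not change. In
`fixedCount_liftPerm`, by contrast, `0` is a cycle of its own and carries a free index. -/
theorem fixedCount_swap_mul_liftPerm {k : ℕ} (q : Fin k) (e : Equiv.Perm (Fin k)) :
    fixedCount n (Equiv.swap 0 q.succ * liftPerm k e) = fixedCount n e := by
  refine Fintype.card_congr
    { toFun := fun z => ⟨Fin.tail z.1, ((comp_swap_mul_liftPerm_eq_iff q e z.1).1 z.2).2⟩
      invFun := fun w => ⟨Fin.cons (w.1 q) w.1, (comp_swap_mul_liftPerm_eq_iff q e _).2 (by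
        simpa using w.2)⟩
      left_inv := fun z => Subtype.ext (by
        conv_rhs => rw [← Fin.cons_self_tail z.1, ((comp_swap_mul_liftPerm_eq_iff q e z.1).1 z.2).1])
      right_inv := fun w => by simp }

theorem fixedCount_inv {k : ℕ} (π : Equiv.Perm (Fin k)) :
    fixedCount n π⁻¹ = fixedCount n π := by
  refine Fintype.card_congr (Equiv.subtypeEquivRight fun z => ?_)
  rw [comp_perm_eq_iff, inv_inv, eq_comm]

/-- Split `S_{k+1}` into cosets of the stabilizer of `0`, with representatives the transpositions
`(0 p)`. The trivial coset multiplies the weight by the dimension and the others leave it unchanged.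
-/
theorem sum_fixedCount_smul_succ {k : ℕ} {E : Type*} [AddCommMonoid E] [Module ℂ E]
    (f : Equiv.Perm (Fin (k + 1)) → E) :
    ∑ π, (fixedCount n π : ℂ) • f π =
      ∑ e : Equiv.Perm (Fin k), (fixedCount n e : ℂ) •
        ((Fintype.card n : ℂ) • f (liftPerm k e) +
          ∑ q : Fin k, f (Equiv.swap 0 q.succ * liftPerm k e)) := by
  rw [← Equiv.sum_comp Equiv.Perm.decomposeFin.symm, Fintype.sum_prod_type_right]
  refine Finset.sum_congr rfl fun e _ => ?_
  simp only [Fin.sum_univ_succ, decomposeFin_symm_eq_mul, fixedCount_swap_mul_liftPerm,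
    Equiv.swap_self, smul_add, Finset.smul_sum]
  congr 1
  change (fixedCount n (1 * liftPerm k e) : ℂ) • f (1 * liftPerm k e) = _
  rw [one_mul, fixedCount_liftPerm, smul_smul, Nat.cast_mul, mul_comm]

theorem sum_fixedCount (k : ℕ) : ∑ π : Equiv.Perm (Fin k), (fixedCount n π : ℂ) =
    ∏ i ∈ Finset.range k, ((Fintype.card n : ℂ) + i) := by
  induction k with
  | zero => simp [fixedCount]
  | succ k ih =>
    have := sum_fixedCount_smul_succ (n := n) (k := k) fun _ => (1 : ℂ)
    simp only [smul_eq_mul, mul_one, Finset.sum_const, Finset.card_univ, Fintype.card_fin,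
      nsmul_eq_mul] at this
    rw [this, ← Finset.sum_mul, ih, Finset.prod_range_succ]

/-- One step of the Jucys–Murphy factorization: the new factor is the dimension plus the sum of the
transpositions moving `0`. -/
theorem traceWeighted_succ {k : ℕ} (ρ : Equiv.Perm (Fin (k + 1)) →* Matrix m m ℂ) :
    traceWeighted n ρ = ((Fintype.card n : ℂ) • 1 + ∑ q : Fin k, ρ (Equiv.swap 0 q.succ)) *
      traceWeighted n (ρ.comp (liftPerm k)) := by
  rw [traceWeighted, traceWeighted, sum_fixedCount_smul_succ, Finset.mul_sum]
  refine Finset.sum_congr rfl fun e _ => ?_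
  simp [add_mul, Finset.sum_mul]

theorem traceWeighted_isHermitian {k : ℕ} {ρ : Equiv.Perm (Fin k) →* Matrix m m ℂ}
    (hρ : ∀ π, (ρ π).conjTranspose = ρ π⁻¹) : (traceWeighted n ρ).IsHermitian := by
  rw [Matrix.IsHermitian, traceWeighted, Matrix.conjTranspose_sum,
    ← Equiv.sum_comp (Equiv.inv (Equiv.Perm (Fin k)))]
  refine Finset.sum_congr rfl fun π _ => ?_
  simp [Matrix.conjTranspose_smul, hρ, fixedCount_inv]

theorem posSemidef_one_add_of_involution {T : Matrix m m ℂ} (hT : T.IsHermitian)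
    (h : T * T = 1) : (1 + T).PosSemidef := by
  have h1 := (Matrix.posSemidef_conjTranspose_mul_self (1 + T)).smul_real (r := 1 / 2) (by norm_num)
  convert h1 using 1
  rw [Matrix.conjTranspose_add, Matrix.conjTranspose_one, hT.eq, add_mul, mul_add, mul_add, h]
  simp only [one_mul, mul_one]
  rw [show (1 : Matrix m m ℂ) + T + (T + 1) = (2 : ℂ) • (1 + T) by rw [two_smul]; abel, smul_smul]
  norm_num

/-- Each of the `k` transpositions is represented by a Hermitian involution, hence lies between `-1`
and `1`. -/
theorem spectrumBetween_sum_swap {k : ℕ} {ρ : Equiv.Perm (Fin (k + 1)) →* Matrix m m ℂ}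
    (hρ : ∀ π, (ρ π).conjTranspose = ρ π⁻¹) :
    SpectrumBetween ((Fintype.card n : ℝ) - k) ((Fintype.card n : ℝ) + k)
      ((Fintype.card n : ℂ) • 1 + ∑ q : Fin k, ρ (Equiv.swap 0 q.succ)) := by
  have hh : ∀ q : Fin k, (ρ (Equiv.swap 0 q.succ)).IsHermitian := fun q => by
    rw [Matrix.IsHermitian, hρ, Equiv.swap_inv]
  have hi : ∀ q : Fin k, ρ (Equiv.swap 0 q.succ) * ρ (Equiv.swap 0 q.succ) = 1 := fun q => by
    rw [← map_mul, Equiv.swap_mul_self, map_one]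
  have hone : (k : ℂ) • (1 : Matrix m m ℂ) = k := by rw [Nat.cast_smul_eq_nsmul, nsmul_one]
  constructor
  · have h1 := Matrix.posSemidef_sum Finset.univ fun (q : Fin k) _ =>
      posSemidef_one_add_of_involution (hh q) (hi q)
    convert h1 using 1
    rw [Finset.sum_add_distrib]
    simp [sub_smul, hone, add_comm]
  · have h1 := Matrix.posSemidef_sum Finset.univ fun (q : Fin k) _ =>
      posSemidef_one_add_of_involution (hh q).neg (by rw [neg_mul_neg, hi q])
    convert h1 using 1
    rw [Finset.sum_add_distrib]
    simp [add_smul, hone]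
    abel

/-- The spectrum of `∑ π, tr(π) π` lies between `∏ (D - i)` and `∏ (D + i)` in every unitary
representation of the symmetric group, `D` being the dimension. -/
theorem spectrumBetween_traceWeighted {k : ℕ} (hk : k ≤ Fintype.card n)
    {ρ : Equiv.Perm (Fin k) →* Matrix m m ℂ} (hρ : ∀ π, (ρ π).conjTranspose = ρ π⁻¹) :
    SpectrumBetween (∏ i ∈ Finset.range k, ((Fintype.card n : ℝ) - i))
      (∏ i ∈ Finset.range k, ((Fintype.card n : ℝ) + i)) (traceWeighted n ρ) := by
  induction k with
  | zero =>
    have h : traceWeighted n ρ = 1 := by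
      rw [traceWeighted, Fintype.sum_eq_single 1 fun π hπ => (hπ (Subsingleton.elim _ _)).elim]
      simp [fixedCount]
    rw [h]
    constructor <;> simpa using Matrix.PosSemidef.zero
  | succ k ih =>
    have hρ' : ∀ e, (ρ.comp (liftPerm k) e).conjTranspose = ρ.comp (liftPerm k) e⁻¹ := fun e => by
      simp [hρ]
    have h1 := ih (k.le_succ.trans hk) hρ'
    have h2 := spectrumBetween_sum_swap (n := n) hρ
    have hk' : (k : ℝ) + 1 ≤ Fintype.card n := by exact_mod_cast hk
    have h0 : 0 ≤ ∏ i ∈ Finset.range k, ((Fintype.card n : ℝ) - i) :=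
      Finset.prod_nonneg fun i hi => by
        have : (i : ℝ) < k := by exact_mod_cast Finset.mem_range.1 hi
        linarith
    rw [traceWeighted_succ, Finset.prod_range_succ, Finset.prod_range_succ, mul_comm _ (_ - _),
      mul_comm _ (_ + (k : ℝ))]
    refine h2.mul h1 (by linarith) h0 (by positivity) ?_
    refine Matrix.IsHermitian.commute_of_mul (h2.posSemidef (by linarith)).1
      (h1.posSemidef h0).1 ?_
    rw [← traceWeighted_succ]
    exact traceWeighted_isHermitian hρ

end JucysMurphy

/-! ### The Haar twirl -/

section HaarTwirl

variable {k : ℕ} {m n Ω : Type*} [Fintype m] [Fintype n] [DecidableEq n]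

theorem integral_matrix_mul_mul [MeasurableSpace Ω] {μ : Measure Ω} {F : Ω → Matrix m m ℂ}
    (hF : ∀ x y, Integrable (fun ω => F ω x y) μ) (M M' : Matrix m m ℂ) (x y : m) :
    (M * Matrix.of (fun x y => ∫ ω, F ω x y ∂μ) * M') x y = ∫ ω, (M * F ω * M') x y ∂μ := by
  simp only [Matrix.mul_apply, Finset.sum_mul, Matrix.of_apply]
  rw [integral_finsetSum _ fun i _ => integrable_finsetSum _ fun j _ =>
    ((hF j i).const_mul _).mul_const _]
  refine Finset.sum_congr rfl fun i _ => ?_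
  rw [integral_finsetSum _ fun j _ => ((hF j i).const_mul _).mul_const _]
  refine Finset.sum_congr rfl fun j _ => ?_
  rw [integral_mul_const, integral_const_mul]

theorem integral_trace_mul [MeasurableSpace Ω] {μ : Measure Ω} {F : Ω → Matrix m m ℂ}
    (hF : ∀ x y, Integrable (fun ω => F ω x y) μ) (M : Matrix m m ℂ) :
    (M * Matrix.of (fun x y => ∫ ω, F ω x y ∂μ)).trace = ∫ ω, (M * F ω).trace ∂μ := by
  simp only [Matrix.trace, Matrix.diag_apply, Matrix.mul_apply, Matrix.of_apply]
  have h : ∀ i j, Integrable (fun ω => M i j * F ω j i) μ := fun i j => (hF j i).const_mul _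
  rw [integral_finsetSum _ fun i _ => integrable_finsetSum _ fun j _ => h i j]
  refine Finset.sum_congr rfl fun i _ => ?_
  rw [integral_finsetSum _ fun j _ => h i j]
  refine Finset.sum_congr rfl fun j _ => ?_
  rw [integral_const_mul]

theorem posSemidef_integral [MeasurableSpace Ω] {μ : Measure Ω} {F : Ω → Matrix m m ℂ}
    (hF : ∀ x y, Integrable (fun ω => F ω x y) μ) (hpos : ∀ ω, (F ω).PosSemidef) :
    (Matrix.of fun x y => ∫ ω, F ω x y ∂μ).PosSemidef := by
  refine Matrix.PosSemidef.of_dotProduct_mulVec_nonneg ?_ fun v => ?_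
  · ext x y
    rw [Matrix.conjTranspose_apply, Matrix.of_apply, Matrix.of_apply]
    refine integral_conj.symm.trans (integral_congr_ae (ae_of_all _ fun ω => ?_))
    exact congrFun (congrFun (hpos ω).1.eq x) y
  · have h : star v ⬝ᵥ (Matrix.of fun x y => ∫ ω, F ω x y ∂μ).mulVec v =
        ∫ ω, star v ⬝ᵥ (F ω).mulVec v ∂μ := by
      have := integral_trace_mul hF (Matrix.vecMulVec v (star v))
      simpa only [Matrix.trace_mul_comm (Matrix.vecMulVec v (star v)), Matrix.mul_vecMulVec,
        Matrix.trace_vecMulVec, dotProduct_comm _ (star v)] using this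
    have h2 : ∀ ω, star v ⬝ᵥ (F ω).mulVec v = ((star v ⬝ᵥ (F ω).mulVec v).re : ℂ) := fun ω =>
      Complex.ext rfl (by
        simpa using (Complex.nonneg_iff.1 ((hpos ω).dotProduct_mulVec_nonneg v)).2.symm)
    rw [h, integral_congr_ae (ae_of_all _ h2), integral_complex_ofReal]
    exact Complex.zero_le_real.2 (integral_nonneg fun ω =>
      (Complex.nonneg_iff.1 ((hpos ω).dotProduct_mulVec_nonneg v)).1)

variable (μ : Measure (Matrix.unitaryGroup n ℂ)) [IsFiniteMeasure μ]

theorem mul_twirl_mul (M M' A : Matrix (Fin k → n) (Fin k → n) ℂ) (x y : Fin k → n) :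
    (M * twirl μ k A * M') x y = ∫ U, (M * conjTensorPow k U A * M') x y ∂μ :=
  integral_matrix_mul_mul (integrable_conjTensorPow μ k A) M M' x y

theorem trace_mul_twirl (M A : Matrix (Fin k → n) (Fin k → n) ℂ) :
    (M * twirl μ k A).trace = ∫ U, (M * conjTensorPow k U A).trace ∂μ :=
  integral_trace_mul (integrable_conjTensorPow μ k A) M

theorem twirl_posSemidef {A : Matrix (Fin k → n) (Fin k → n) ℂ} (hA : A.PosSemidef) :
    (twirl μ k A).PosSemidef :=
  posSemidef_integral (integrable_conjTensorPow μ k A) fun _ => hA.mul_mul_conjTranspose_same _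

theorem conjTensorPow_mul (V U : Matrix.unitaryGroup n ℂ) (A : Matrix (Fin k → n) (Fin k → n) ℂ) :
    conjTensorPow k (V * U) A = tensorPow k (V : Matrix n n ℂ) * conjTensorPow k U A *
      (tensorPow k (V : Matrix n n ℂ)).conjTranspose := by
  simp only [conjTensorPow, Submonoid.coe_mul, ← tensorPow_mul, Matrix.conjTranspose_mul,
    Matrix.mul_assoc]

instance haarUnitary_isMulLeftInvariant : (haarUnitary n).IsMulLeftInvariant := by
  unfold haarUnitary; infer_instance

theorem commute_twirl_haarUnitary (A : Matrix (Fin k → n) (Fin k → n) ℂ)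
    (V : Matrix.unitaryGroup n ℂ) :
    Commute (twirl (haarUnitary n) k A) (tensorPow k (V : Matrix n n ℂ)) := by
  have h : tensorPow k (V : Matrix n n ℂ) * twirl (haarUnitary n) k A *
      (tensorPow k (V : Matrix n n ℂ)).conjTranspose = twirl (haarUnitary n) k A := by
    ext x y
    rw [mul_twirl_mul]
    simp only [← conjTensorPow_mul]
    exact integral_mul_left_eq_self (fun U => conjTensorPow k U A x y) V
  calc twirl (haarUnitary n) k A * tensorPow k (V : Matrix n n ℂ)
      = tensorPow k (V : Matrix n n ℂ) * twirl (haarUnitary n) k A *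
        ((tensorPow k (V : Matrix n n ℂ)).conjTranspose * tensorPow k (V : Matrix n n ℂ)) := by
        rw [← mul_assoc, h]
    _ = _ := by rw [tensorPow_unitary_conjTranspose_mul, mul_one]

theorem trace_conjTensorPow_mul_permMat (U : Matrix.unitaryGroup n ℂ)
    (A : Matrix (Fin k → n) (Fin k → n) ℂ) (π : Equiv.Perm (Fin k)) :
    (permMat n π * conjTensorPow k U A).trace = (A * permMat n π).trace := by
  rw [conjTensorPow, mul_assoc (tensorPow k _), ← mul_assoc,
    (permMat_commute_tensorPow π (U : Matrix n n ℂ)).eq, mul_assoc, Matrix.trace_mul_comm,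
    mul_assoc, mul_assoc, tensorPow_unitary_conjTranspose_mul, mul_one,
    Matrix.trace_mul_comm]

theorem trace_twirl_mul_permMat [IsProbabilityMeasure μ] (A : Matrix (Fin k → n) (Fin k → n) ℂ)
    (π : Equiv.Perm (Fin k)) :
    (twirl μ k A * permMat n π).trace = (A * permMat n π).trace := by
  rw [Matrix.trace_mul_comm, trace_mul_twirl]
  simp [trace_conjTensorPow_mul_permMat]

/-- The Haar twirl lies in the commutant by left invariance, and twirling preserves traces against
permutations because these commute with `U^{⊗k}`. -/
theorem traceWeighted_mul_twirl (A : Matrix (Fin k → n) (Fin k → n) ℂ) :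
    traceWeighted n (permMat n) * twirl (haarUnitary n) k A =
      ∑ π, (A * permMat n π⁻¹).trace • permMat n π := by
  rw [traceWeighted_mul (commute_twirl_haarUnitary A)]
  simp only [trace_twirl_mul_permMat]

/-- The symmetrizer `∑ π, π` (without normalization). -/
def symmetrizer (n : Type*) [Fintype n] [DecidableEq n] (k : ℕ) :
    Matrix (Fin k → n) (Fin k → n) ℂ :=
  ∑ π, permMat n π

theorem symmetrizer_isHermitian : (symmetrizer n k).IsHermitian := by
  rw [Matrix.IsHermitian, symmetrizer, Matrix.conjTranspose_sum,
    ← Equiv.sum_comp (Equiv.inv (Equiv.Perm (Fin k)))]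
  simp [permMat_conjTranspose]

theorem haarStateMoment_eq_twirl [Inhabited n] : haarStateMoment n k =
    twirl (haarUnitary n) k (Matrix.single (fun _ => default) (fun _ => default) 1) := by
  ext x y
  refine integral_congr_ae (ae_of_all _ fun U => ?_)
  have h : tensorPow k (Matrix.vecMulVec ((U : Matrix n n ℂ).mulVec (Pi.single default 1))
      (star ((U : Matrix n n ℂ).mulVec (Pi.single default 1)))) =
      conjTensorPow k U (Matrix.single (fun _ => default) (fun _ => default) 1) := by
    rw [conjTensorPow, ← tensorProd_single, tensorPow_conjTranspose]
    change _ = tensorPow k _ * tensorPow k _ * tensorPow k _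
    rw [tensorPow_mul, tensorPow_mul, Matrix.star_mulVec, ← Matrix.mul_vecMulVec,
      ← Matrix.vecMulVec_mul, ← mul_assoc]
    congr
    ext i j
    by_cases hi : i = default <;> by_cases hj : j = default <;>
      simp [Matrix.vecMulVec_apply, hi, hj, eq_comm]
  exact congrFun (congrFun h x) y

/-- The moments of the Haar random state are given by the symmetrizer. -/
theorem haarStateMoment_eq_symmetrizer [Inhabited n] :
    (∏ i ∈ Finset.range k, ((Fintype.card n : ℂ) + i)) • haarStateMoment n k =
      symmetrizer n k := by
  -- The moment lives on the symmetric subspace, where every permutation acts as `1`. The weighted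
  -- sum therefore acts as the scalar `∑ π, tr(π) = ∏ (D + i)`.
  have hperm : ∀ π : Equiv.Perm (Fin k),
      permMat n π * haarStateMoment n k = haarStateMoment n k := by
    intro π
    ext x y
    rw [permMat_mul_apply]
    refine integral_congr_ae (ae_of_all _ fun U => ?_)
    simp only [tensorPow, tensorProd_apply, Matrix.vecMulVec_apply, Finset.prod_mul_distrib,
      Function.comp_apply]
    congr 1
    exact Equiv.prod_comp π fun i => (U : Matrix n n ℂ).mulVec (Pi.single default 1) (x i)
  have h := traceWeighted_mul_twirl (n := n) (k := k)
    (Matrix.single (fun _ => default) (fun _ => default) 1)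
  rw [← haarStateMoment_eq_twirl, traceWeighted, Finset.sum_mul] at h
  simp only [Matrix.smul_mul, hperm] at h
  rw [← Finset.sum_smul, sum_fixedCount] at h
  rw [h, symmetrizer]
  refine Finset.sum_congr rfl fun π _ => ?_
  have : ((Matrix.single (fun _ => default) (fun _ => default) 1 :
      Matrix (Fin k → n) (Fin k → n) ℂ) * permMat n π⁻¹).trace = 1 := by
    rw [trace_mul_permMat_inv, Fintype.sum_eq_single (fun _ => default)]
    · simp [Matrix.single_apply, funext_iff]
    · intro x hx
      simp [hx.symm]
  rw [this, one_smul]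

end HaarTwirl

/-! ### Choi states of approximate designs -/

section Choi

variable {k : ℕ} {n : Type*} [Fintype n] [DecidableEq n]

/-- The Choi matrix of a map acting on one half of `(ℂ^n ⊗ ℂ^n)^{⊗ k}`. -/
def choiMatrix (Φ : Matrix (Fin k → n) (Fin k → n) ℂ →ₗ[ℂ] Matrix (Fin k → n) (Fin k → n) ℂ) :
    Matrix (Fin k → n × n) (Fin k → n × n) ℂ :=
  Matrix.of fun X Y => Φ (Matrix.single (fun i => (X i).2) (fun i => (Y i).2) 1)
    (fun i => (X i).1) (fun i => (Y i).1)

theorem IsCompletelyPositive.posSemidef_choiMatrix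
    {Φ : Matrix (Fin k → n) (Fin k → n) ℂ →ₗ[ℂ] Matrix (Fin k → n) (Fin k → n) ℂ}
    (h : IsCompletelyPositive Φ) : (choiMatrix Φ).PosSemidef := by
  let e := Fintype.equivFin (Fin k → n)
  -- Complete positivity is tested on the unnormalized maximally entangled projector, with an
  -- ancilla as large as the system.
  have h1 := h _ _ (Matrix.posSemidef_vecMulVec_self_star
    fun p : (Fin k → n) × Fin (Fintype.card (Fin k → n)) => if p.1 = e.symm p.2 then (1 : ℂ) else 0)
  convert h1.submatrix fun X : Fin k → n × n => ((fun i => (X i).1), e fun i => (X i).2) using 1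
  ext X Y
  simp only [choiMatrix, Matrix.of_apply, Matrix.submatrix_apply]
  refine congrFun (congrFun (congrArg Φ ?_) _) _
  ext x y
  by_cases hx : x = (fun i => (X i).2) <;> by_cases hy : y = (fun i => (Y i).2) <;>
    simp [Matrix.vecMulVec_apply, hx, hy, eq_comm]

theorem IsCompletelyPositive.posSemidef_apply {m : Type*} [Fintype m]
    {Φ : Matrix m m ℂ →ₗ[ℂ] Matrix m m ℂ} (h : IsCompletelyPositive Φ) {A : Matrix m m ℂ}
    (hA : A.PosSemidef) : (Φ A).PosSemidef :=
  (h 1 _ (hA.submatrix Prod.fst)).submatrix fun x => (x, 0)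

theorem choiState_apply (U : Matrix.unitaryGroup n ℂ) (p : n × n) :
    choiState U p = (U : Matrix n n ℂ) p.1 p.2 * ((Real.sqrt (Fintype.card n))⁻¹ : ℝ) := by
  rw [choiState, Matrix.mulVec, dotProduct, Fintype.sum_prod_type,
    Fintype.sum_eq_single p.2, Fintype.sum_eq_single p.2]
  · simp [eprState]
  · intro j hj
    simp [eprState, hj.symm]
  · intro i hi
    refine Finset.sum_eq_zero fun j _ => ?_
    by_cases hj : p.2 = j
    · subst hj
      simp [eprState, hi]
    · simp [Matrix.one_apply_ne hj]

theorem conjTensorPow_single_apply (U : Matrix.unitaryGroup n ℂ) (x y a b : Fin k → n) :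
    conjTensorPow k U (Matrix.single x y 1) a b =
      ∏ i, ((U : Matrix n n ℂ) (a i) (x i) * star ((U : Matrix n n ℂ) (b i) (y i))) := by
  rw [conjTensorPow, ← tensorProd_single, tensorPow_conjTranspose, tensorPow, tensorPow,
    tensorProd_mul, tensorProd_mul, tensorProd_apply]
  refine Finset.prod_congr rfl fun i _ => ?_
  rw [Matrix.mul_apply, Finset.sum_eq_single (y i), Matrix.mul_apply,
    Finset.sum_eq_single (x i)]
  · simp
  · intro j _ hj
    simp [hj.symm]
  · simp
  · intro j _ hj
    simp [Matrix.mul_apply, hj.symm]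
  · simp

theorem stateMoment_choiState (μ : Measure (Matrix.unitaryGroup n ℂ)) [IsFiniteMeasure μ] :
    stateMoment μ choiState k =
      ((((Fintype.card n : ℝ) ^ k)⁻¹ : ℝ) : ℂ) • choiMatrix (twirl μ k) := by
  ext X Y
  rw [Matrix.smul_apply, smul_eq_mul]
  refine Eq.trans (integral_congr_ae (ae_of_all _ fun U => ?_)) (integral_const_mul _ _)
  have hs : (Real.sqrt (Fintype.card n))⁻¹ * (Real.sqrt (Fintype.card n))⁻¹ =
      (Fintype.card n : ℝ)⁻¹ := by
    rw [← mul_inv, Real.mul_self_sqrt (Nat.cast_nonneg _)]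
  rw [conjTensorPow_single_apply]
  simp only [tensorPow, tensorProd_apply, Matrix.vecMulVec_apply, choiState_apply, Pi.star_apply]
  rw [← inv_pow, ← hs, Complex.ofReal_pow, ← Fin.prod_const, ← Finset.prod_mul_distrib]
  refine Finset.prod_congr rfl fun i _ => ?_
  rw [star_mul', Complex.star_def, Complex.conj_ofReal, Complex.ofReal_mul]
  ring

/-- The permutation operators acting on the first halves of `(ℂ^n ⊗ ℂ^n)^{⊗ k}`. -/
def permMatFst (n : Type*) [Fintype n] [DecidableEq n] (k : ℕ) :
    Equiv.Perm (Fin k) →* Matrix (Fin k → n × n) (Fin k → n × n) ℂ where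
  toFun π := (permMat n π ⊗ₖ (1 : Matrix (Fin k → n) (Fin k → n) ℂ)).submatrix
    (Equiv.arrowProdEquivProdArrow (Fin k) (fun _ => n) (fun _ => n))
    (Equiv.arrowProdEquivProdArrow (Fin k) (fun _ => n) (fun _ => n))
  map_one' := by simp
  map_mul' π σ := by
    rw [Matrix.submatrix_mul_equiv, ← Matrix.mul_kronecker_mul, map_mul, one_mul]

theorem permMatFst_conjTranspose (π : Equiv.Perm (Fin k)) :
    (permMatFst n k π).conjTranspose = permMatFst n k π⁻¹ := by
  change (Matrix.submatrix _ _ _).conjTranspose = Matrix.submatrix _ _ _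
  rw [Matrix.conjTranspose_submatrix, Matrix.conjTranspose_kronecker, permMat_conjTranspose,
    Matrix.conjTranspose_one]

theorem permMatFst_mul_apply (π : Equiv.Perm (Fin k))
    (A : Matrix (Fin k → n × n) (Fin k → n × n) ℂ) (X Y : Fin k → n × n) :
    (permMatFst n k π * A) X Y = A (fun i => ((X (π i)).1, (X i).2)) Y := by
  rw [Matrix.mul_apply, Fintype.sum_eq_single fun i => ((X (π i)).1, (X i).2)]
  · simp [permMatFst, permMat_apply, Equiv.arrowProdEquivProdArrow, Function.comp_def]
  · intro Z hZ
    have : ¬ ((fun i => (X (π i)).1) = (fun i => (Z i).1) ∧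
        (fun i => (X i).2) = fun i => (Z i).2) := by
      rintro ⟨h1, h2⟩
      exact hZ (funext fun i => Prod.ext (congrFun h1 i).symm (congrFun h2 i).symm)
    simp only [permMatFst, MonoidHom.coe_mk, OneHom.coe_mk, Matrix.submatrix_apply,
      Matrix.kroneckerMap_apply, permMat_apply, Matrix.one_apply,
      Equiv.arrowProdEquivProdArrow, Equiv.coe_fn_mk, Function.comp_def]
    rw [ite_zero_mul_ite_zero, if_neg this, zero_mul]

/-- In `traceWeighted_mul_twirl` for a matrix unit, the trace permutes the input indices and the
operator permutes the output indices. Together they permute the pairs, which gives the symmetrizer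
of the doubled system. -/
theorem traceWeighted_mul_choiMatrix :
    traceWeighted n (permMatFst n k) * choiMatrix (twirl (haarUnitary n) k) =
      symmetrizer (n × n) k := by
  ext X Y
  have h := congrFun (congrFun (traceWeighted_mul_twirl (n := n) (k := k)
    (Matrix.single (fun i => (X i).2) (fun i => (Y i).2) 1)) fun i => (X i).1) fun i => (Y i).1
  simp only [traceWeighted, Finset.sum_mul, Matrix.sum_apply, Matrix.smul_mul, Matrix.smul_apply,
    permMat_mul_apply, symmetrizer, permMatFst_mul_apply] at h ⊢
  refine h.trans (Finset.sum_congr rfl fun π _ => ?_)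
  have ht : (Matrix.single (fun i => (X i).2) (fun i => (Y i).2) (1 : ℂ) *
      permMat n π⁻¹).trace = if (fun i => (X i).2) ∘ π = fun i => (Y i).2 then 1 else 0 := by
    rw [trace_mul_permMat_inv, Fintype.sum_eq_single fun i => (X i).2]
    · simp [Matrix.single_apply, eq_comm]
    · intro x hx
      simp [hx.symm]
  rw [ht, permMat_apply, permMat_apply, smul_eq_mul, ite_zero_mul_ite_zero, one_mul]
  refine if_congr ?_ rfl rfl
  simp only [funext_iff, Function.comp_apply, ← forall_and, Prod.ext_iff, and_comm]

theorem choiMatrix_twirl_posSemidef (μ : Measure (Matrix.unitaryGroup n ℂ)) [IsFiniteMeasure μ] :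
    (choiMatrix (twirl μ k)).PosSemidef := by
  let F : Matrix.unitaryGroup n ℂ → Matrix (Fin k → n × n) (Fin k → n × n) ℂ := fun U =>
    Matrix.of fun X Y => conjTensorPow k U
      (Matrix.single (fun i => (X i).2) (fun i => (Y i).2) 1) (fun i => (X i).1) fun i => (Y i).1
  have hF : ∀ X Y, Integrable (fun U => F U X Y) μ := fun X Y =>
    integrable_conjTensorPow μ k _ _ _
  have hpos : ∀ U, (F U).PosSemidef := fun U => by
    convert Matrix.posSemidef_vecMulVec_self_star
      (fun X : Fin k → n × n => ∏ i, (U : Matrix n n ℂ) (X i).1 (X i).2) using 1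
    ext X Y
    refine (conjTensorPow_single_apply U _ _ _ _).trans ?_
    rw [Finset.prod_mul_distrib,
      Matrix.vecMulVec_apply, Pi.star_apply, star_prod]
  exact posSemidef_integral hF hpos

end Choi

/-! ### Elementary estimates for `∏ (1 ± i x)` -/

section Numerics

theorem prod_one_add_le {x : ℝ} (hx : 0 ≤ x) (k : ℕ) (h : (k : ℝ) ^ 2 * x ≤ 1) :
    ∏ i ∈ Finset.range k, (1 + i * x) ≤ 1 + (k : ℝ) ^ 2 * x := by
  induction k with
  | zero => simp
  | succ k ih =>
    push_cast at h ⊢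
    have hk : (0 : ℝ) ≤ k := k.cast_nonneg
    have h1 : (k : ℝ) ^ 2 * x ≤ 1 := by nlinarith
    rw [Finset.prod_range_succ]
    have h2 := mul_le_mul_of_nonneg_right (ih h1) (by positivity : 0 ≤ 1 + (k : ℝ) * x)
    have h3 := mul_le_mul_of_nonneg_right h1 (by positivity : 0 ≤ (k : ℝ) * x)
    nlinarith

theorem one_le_prod_one_sub_mul {x : ℝ} (hx : 0 ≤ x) (k : ℕ) (h : (k : ℝ) ^ 2 * x ≤ 1) :
    1 ≤ (∏ i ∈ Finset.range k, (1 - i * x)) * (1 + (k : ℝ) ^ 2 * x) := by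
  induction k with
  | zero => simp
  | succ k ih =>
    push_cast at h ⊢
    have hk : (0 : ℝ) ≤ k := k.cast_nonneg
    have h1 : (k : ℝ) ^ 2 * x ≤ 1 := by nlinarith
    rw [Finset.prod_range_succ]
    have h0 : 0 ≤ ∏ i ∈ Finset.range k, (1 - i * x) := Finset.prod_nonneg fun i hi => by
      have : (i : ℝ) + 1 ≤ k := by exact_mod_cast Finset.mem_range.1 hi
      have hi0 : (0 : ℝ) ≤ i := i.cast_nonneg
      nlinarith
    refine (ih h1).trans ?_
    rw [mul_assoc]
    refine mul_le_mul_of_nonneg_left ?_ h0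
    have h3 := mul_le_mul_of_nonneg_right h (by positivity : 0 ≤ (k : ℝ) * x)
    nlinarith

theorem prod_add_eq {D : ℝ} (hD : D ≠ 0) (k : ℕ) :
    ∏ i ∈ Finset.range k, (D + i) = D ^ k * ∏ i ∈ Finset.range k, (1 + i * D⁻¹) := by
  rw [← Finset.card_range k, ← Finset.prod_const, Finset.card_range, ← Finset.prod_mul_distrib]
  refine Finset.prod_congr rfl fun i _ => ?_
  field_simp

theorem prod_sub_eq {D : ℝ} (hD : D ≠ 0) (k : ℕ) :
    ∏ i ∈ Finset.range k, (D - i) = D ^ k * ∏ i ∈ Finset.range k, (1 - i * D⁻¹) := by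
  rw [← Finset.card_range k, ← Finset.prod_const, Finset.card_range, ← Finset.prod_mul_distrib]
  refine Finset.prod_congr rfl fun i _ => ?_
  field_simp

end Numerics

/-! ### Comparison of Choi ensembles with Haar random states -/

section ChoiDesign

variable {k : ℕ} {n : Type*} [Fintype n] [DecidableEq n] [Inhabited n]

theorem haarStateMoment_posSemidef : (haarStateMoment n k).PosSemidef := by
  rw [haarStateMoment_eq_twirl]
  refine twirl_posSemidef _ ?_
  convert Matrix.posSemidef_vecMulVec_self_star
    (Pi.single (fun _ => default) 1 : (Fin k → n) → ℂ) using 1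
  ext x y
  by_cases hx : x = fun _ => default <;> by_cases hy : y = fun _ => default <;>
    simp [Matrix.vecMulVec_apply, hx, hy, eq_comm]

theorem stateMoment_choiState_posSemidef (μ : Measure (Matrix.unitaryGroup n ℂ))
    [IsFiniteMeasure μ] : (stateMoment μ choiState k).PosSemidef := by
  rw [stateMoment_choiState]
  exact (choiMatrix_twirl_posSemidef μ).smul_real (by positivity)

/-- The moments of Choi states of Haar random unitaries, compared with those of Haar random
states. -/
theorem haar_choiState_bounds (hk : k ^ 2 ≤ Fintype.card n) :
    ((((1 + (k : ℝ) ^ 2 / Fintype.card n) * (1 + (k : ℝ) ^ 2 / (Fintype.card n : ℝ) ^ 2) : ℝ) : ℂ) •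
        haarStateMoment (n × n) k - stateMoment (haarUnitary n) choiState k).PosSemidef ∧
    (((1 + (k : ℝ) ^ 2 / Fintype.card n : ℝ) : ℂ) • stateMoment (haarUnitary n) choiState k -
        haarStateMoment (n × n) k).PosSemidef := by
  obtain ⟨D, hD⟩ : ∃ D : ℝ, D = (Fintype.card n : ℝ) := ⟨_, rfl⟩
  rw [← hD]
  have hD1 : 1 ≤ D := by rw [hD]; exact_mod_cast Fintype.card_pos (α := n)
  have hD0 : D ≠ 0 := by positivity
  have hk2 : (k : ℝ) ^ 2 ≤ D := by rw [hD]; exact_mod_cast hk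
  set R := haarStateMoment (n × n) k with hR
  set S := stateMoment (haarUnitary n) (choiState (n := n)) k with hS
  have hRp : R.PosSemidef := haarStateMoment_posSemidef
  have hSp : S.PosSemidef := stateMoment_choiState_posSemidef _
  have hkD : k ≤ Fintype.card n := le_trans (by nlinarith [Nat.zero_le k]) hk
  obtain ⟨hlo, hhi⟩ := spectrumBetween_traceWeighted (n := n) hkD
    (permMatFst_conjTranspose (n := n) (k := k))
  rw [← hD, prod_sub_eq hD0] at hlo
  rw [← hD, prod_add_eq hD0] at hhi
  set α := ∏ i ∈ Finset.range k, (1 - i * D⁻¹)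
  set β := ∏ i ∈ Finset.range k, (1 + i * D⁻¹)
  set γ := ∏ i ∈ Finset.range k, (1 + i * (D ^ 2)⁻¹)
  set W := traceWeighted n (permMatFst n k)
  set C := choiMatrix (twirl (haarUnitary n) k)
  have hSC : C = ((D ^ k : ℝ) : ℂ) • S := by
    rw [hS, stateMoment_choiState, ← hD, smul_smul, ← Complex.ofReal_mul, mul_inv_cancel₀ (by positivity),
      Complex.ofReal_one, one_smul]
  have hCp : C.PosSemidef := choiMatrix_twirl_posSemidef _
  have hWC : W * C = ((D ^ k * (D ^ k * γ) : ℝ) : ℂ) • R := by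
    rw [traceWeighted_mul_choiMatrix, ← haarStateMoment_eq_symmetrizer, Fintype.card_prod]
    congr 1
    rw [← mul_assoc, ← mul_pow, ← sq D, ← prod_add_eq (by positivity), hD]
    push_cast
    simp [sq]
  have hcomm : Commute W C := by
    refine Matrix.IsHermitian.commute_of_mul
      (traceWeighted_isHermitian permMatFst_conjTranspose) hCp.1 ?_
    rw [traceWeighted_mul_choiMatrix]
    exact symmetrizer_isHermitian
  have h1 := hlo.mul_of_commute hCp (hcomm.sub_left ((Commute.one_left C).smul_left _))
  have h2 := hhi.mul_of_commute hCp (((Commute.one_left C).smul_left _).sub_left hcomm)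
  rw [sub_mul, hWC, hSC, Matrix.smul_mul, one_mul, smul_smul] at h1 h2
  -- Divided by `D^{2k}`, the two spectral bounds become `α S ≤ γ R ≤ β S`. The rest is numerical:
  -- `1/α` and `β` are at most `1 + k²/D`, and `1 ≤ γ ≤ 1 + k²/D²`.
  have h1' : ((γ : ℂ) • R - (α : ℂ) • S).PosSemidef := by
    convert h1.smul_real (r := (D ^ k * D ^ k)⁻¹) (by positivity) using 1
    rw [smul_sub, smul_smul, smul_smul]
    have : (D : ℂ) ≠ 0 := by exact_mod_cast hD0
    congr 2
    · push_cast; field_simp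
    · push_cast; field_simp
  have h2' : ((β : ℂ) • S - (γ : ℂ) • R).PosSemidef := by
    convert h2.smul_real (r := (D ^ k * D ^ k)⁻¹) (by positivity) using 1
    rw [smul_sub, smul_smul, smul_smul]
    have : (D : ℂ) ≠ 0 := by exact_mod_cast hD0
    congr 2
    · push_cast; field_simp
    · push_cast; field_simp
  have hα : 1 ≤ α * (1 + (k : ℝ) ^ 2 / D) :=
    one_le_prod_one_sub_mul (by positivity) k (by rw [← div_eq_mul_inv]; exact (div_le_one (by positivity)).2 hk2)
  have hβ : β ≤ 1 + (k : ℝ) ^ 2 / D :=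
    prod_one_add_le (by positivity) k (by rw [← div_eq_mul_inv]; exact (div_le_one (by positivity)).2 hk2)
  have hγ : γ ≤ 1 + (k : ℝ) ^ 2 / D ^ 2 :=
    prod_one_add_le (by positivity) k (by
      rw [← div_eq_mul_inv]; exact (div_le_one (by positivity)).2 (by nlinarith))
  have hγ1 : 1 ≤ γ := by
    refine (Finset.prod_const_one (s := Finset.range k)).symm.trans_le
      (Finset.prod_le_prod (fun _ _ => zero_le_one) fun i _ => ?_)
    exact le_add_of_nonneg_right (by positivity)
  have ha : 0 ≤ (k : ℝ) ^ 2 / D := by positivity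
  set a := (k : ℝ) ^ 2 / D
  set b := (k : ℝ) ^ 2 / D ^ 2
  constructor
  · convert ((h1'.smul_real (r := 1 + a) (by linarith)).add
      (hSp.smul_real (r := α * (1 + a) - 1) (by linarith))).add
      (hRp.smul_real (r := (1 + a) * (1 + b - γ)) (mul_nonneg (by linarith) (by linarith))) using 1
    push_cast
    module
  · convert (h2'.add (hSp.smul_real (r := 1 + a - β) (by linarith))).add
      (hRp.smul_real (r := γ - 1) (by linarith)) using 1
    push_cast
    module

/-- The two design conditions add up to positivity of `2ε Φ_Haar`, and the trace of `Φ_Haar(1)` is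
the positive dimension of the tensor power. -/
theorem IsRelativeUnitaryDesign.nonneg {μ : Measure (Matrix.unitaryGroup n ℂ)} [IsFiniteMeasure μ]
    {ε : ℝ} (h : IsRelativeUnitaryDesign μ k ε) : 0 ≤ ε := by
  by_contra! hε
  have h1 := (h.1.posSemidef_apply Matrix.PosSemidef.one).add
    (h.2.posSemidef_apply Matrix.PosSemidef.one)
  have h2 := (h1.smul_real (r := (-(2 * ε))⁻¹) (inv_nonneg.2 (by linarith))).trace_nonneg
  have h3 : (twirl (haarUnitary n) k 1).trace = Fintype.card (Fin k → n) := by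
    simpa using trace_twirl_mul_permMat (haarUnitary n) (1 : Matrix (Fin k → n) (Fin k → n) ℂ) 1
  simp only [LinearMap.sub_apply, LinearMap.smul_apply, Matrix.trace_smul, Matrix.trace_add,
    Matrix.trace_sub, h3, smul_eq_mul] at h2
  have h4 : (((-(2 * ε))⁻¹ : ℝ) : ℂ) * ((twirl μ k 1).trace - ((1 - ε : ℝ) : ℂ) *
      (Fintype.card (Fin k → n) : ℂ) + (((1 + ε : ℝ) : ℂ) * (Fintype.card (Fin k → n) : ℂ) -
        (twirl μ k 1).trace)) = ((-(Fintype.card (Fin k → n) : ℝ) : ℝ) : ℂ) := by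
    have : (ε : ℂ) ≠ 0 := by exact_mod_cast hε.ne
    push_cast
    field_simp
    ring
  rw [h4, Complex.zero_le_real] at h2
  have : (0 : ℝ) < Fintype.card (Fin k → n) := by exact_mod_cast Fintype.card_pos
  linarith

theorem IsRelativeUnitaryDesign.isRelativeStateDesign_choiState
    {μ : Measure (Matrix.unitaryGroup n ℂ)} [IsFiniteMeasure μ] {ε : ℝ}
    (hk : k ^ 2 ≤ Fintype.card n) (h : IsRelativeUnitaryDesign μ k ε) :
    IsRelativeStateDesign μ choiState k ((1 + ε) * (1 + (k : ℝ) ^ 2 / Fintype.card n) *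
      (1 + (k : ℝ) ^ 2 / (Fintype.card n : ℝ) ^ 2) - 1) := by
  have hε := h.nonneg
  obtain ⟨h1, h2⟩ := haar_choiState_bounds hk
  have hlo := h.1.posSemidef_choiMatrix.smul_real (r := ((Fintype.card n : ℝ) ^ k)⁻¹) (by positivity)
  have hhi := h.2.posSemidef_choiMatrix.smul_real (r := ((Fintype.card n : ℝ) ^ k)⁻¹) (by positivity)
  have e1 : choiMatrix (twirl μ k - ((1 - ε : ℝ) : ℂ) • twirl (haarUnitary n) k) =
    choiMatrix (twirl μ k) - ((1 - ε : ℝ) : ℂ) • choiMatrix (twirl (haarUnitary n) k) := rfl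
  have e2 : choiMatrix (((1 + ε : ℝ) : ℂ) • twirl (haarUnitary n) k - twirl μ k) =
    ((1 + ε : ℝ) : ℂ) • choiMatrix (twirl (haarUnitary n) k) - choiMatrix (twirl μ k) := rfl
  rw [e1, smul_sub, smul_comm, ← stateMoment_choiState, ← stateMoment_choiState] at hlo
  rw [e2, smul_sub, smul_comm, ← stateMoment_choiState, ← stateMoment_choiState] at hhi
  have hRp : (haarStateMoment (n × n) k).PosSemidef := haarStateMoment_posSemidef
  have ha : 0 ≤ (k : ℝ) ^ 2 / Fintype.card n := by positivity
  have hb : 0 ≤ (k : ℝ) ^ 2 / (Fintype.card n : ℝ) ^ 2 := by positivity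
  set R := haarStateMoment (n × n) k
  set S := stateMoment (haarUnitary n) (choiState (n := n)) k
  set a := (k : ℝ) ^ 2 / Fintype.card n
  set b := (k : ℝ) ^ 2 / (Fintype.card n : ℝ) ^ 2
  have hab : 0 ≤ a * b := mul_nonneg ha hb
  have hea : 0 ≤ ε * a := mul_nonneg hε ha
  have heb : 0 ≤ ε * b := mul_nonneg hε hb
  have heab : 0 ≤ ε * (a * b) := mul_nonneg hε hab
  constructor
  -- The lower bound is `(1 - ε) S`. The sign of `1 - ε` decides whether a lower or an upper bound
  -- on `S` in terms of `R` is needed.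
  · rcases le_total ε 1 with h1' | h1'
    · obtain ⟨c, hc⟩ : ∃ c, 1 - ε = c * (1 + a) :=
        ⟨(1 - ε) / (1 + a), (div_mul_cancel₀ _ (by positivity)).symm⟩
      have hc0 : 0 ≤ c := by
        by_contra! h
        nlinarith
      have hc1 : (1 - ε) * (1 - a) ≤ c := by
        rw [hc]
        nlinarith [mul_nonneg hc0 (sq_nonneg a)]
      rw [hc] at hlo
      convert (hlo.add (h2.smul_real (r := c) hc0)).add
        (hRp.smul_real (r := c + (1 + ε) * (1 + a) * (1 + b) - 2) (by nlinarith)) using 1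
      push_cast
      module
    · convert (hlo.add (h1.smul_real (r := ε - 1) (by linarith))).add
        (hRp.smul_real (r := 2 * ((1 + a) * (1 + b)) - 2) (by nlinarith)) using 1
      push_cast
      module
  · convert hhi.add (h1.smul_real (r := 1 + ε) (by linarith)) using 1
    push_cast
    module

end ChoiDesign

/-! ### Pauli strings -/

section Pauli

variable {ι : Type*} [Fintype ι]

/-- The one-qubit Pauli operator `Z^a X^b`. -/
def qubitPauli (a b : Fin 2) : Matrix (Fin 2) (Fin 2) ℂ :=
  !![1, 0; 0, -1] ^ (a : ℕ) * !![0, 1; 1, 0] ^ (b : ℕ)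

theorem pauliString_eq (u v : ι → Fin 2) :
    pauliString u v = tensorProd fun i => qubitPauli (u i) (v i) := rfl

theorem qubitPauli_zero : qubitPauli 0 0 = 1 := by simp [qubitPauli]

theorem qubitPauli_conjTranspose (a b : Fin 2) :
    (qubitPauli a b).conjTranspose = (-1 : ℂ) ^ ((a : ℕ) * (b : ℕ)) • qubitPauli a b := by
  fin_cases a <;> fin_cases b <;> ext i j <;> fin_cases i <;> fin_cases j <;>
    simp [qubitPauli, Matrix.conjTranspose_apply]

theorem qubitPauli_mul (a b c d : Fin 2) :
    qubitPauli a b * qubitPauli c d =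
      (-1 : ℂ) ^ ((b : ℕ) * (c : ℕ)) • qubitPauli (a + c) (b + d) := by
  fin_cases a <;> fin_cases b <;> fin_cases c <;> fin_cases d <;> ext i j <;>
    fin_cases i <;> fin_cases j <;> simp [qubitPauli]

theorem sum_qubitPauli (i j i' j' : Fin 2) :
    ∑ w : Fin 2 × Fin 2, qubitPauli w.1 w.2 i j * star (qubitPauli w.1 w.2 i' j') =
      if i = i' ∧ j = j' then 2 else 0 := by
  fin_cases i <;> fin_cases j <;> fin_cases i' <;> fin_cases j' <;>
    simp [qubitPauli, Fintype.sum_prod_type, one_add_one_eq_two]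

theorem trace_qubitPauli (a b : Fin 2) :
    (qubitPauli a b).trace = if a = 0 ∧ b = 0 then 2 else 0 := by
  fin_cases a <;> fin_cases b <;> simp [qubitPauli, Matrix.trace_fin_two]

/-- The sign `(-1)^{u ⬝ v}`. -/
def pauliSign (u v : ι → Fin 2) : ℂ := ∏ i, (-1 : ℂ) ^ ((u i : ℕ) * (v i : ℕ))

theorem pauliSign_eq_one_or (u v : ι → Fin 2) : pauliSign u v = 1 ∨ pauliSign u v = -1 := by
  rw [pauliSign, Finset.prod_pow_eq_pow_sum]
  exact neg_one_pow_eq_or ℂ _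

theorem pauliSign_mul_self (u v : ι → Fin 2) : pauliSign u v * pauliSign u v = 1 := by
  rcases pauliSign_eq_one_or u v with h | h <;> simp [h]

theorem pauliSign_eq_one {u v : ι → Fin 2} (h : ∀ i, u i = 0 ∨ v i = 0) : pauliSign u v = 1 :=
  Finset.prod_eq_one fun i _ => by rcases h i with h | h <;> simp [h]

theorem pauliString_conjTranspose (u v : ι → Fin 2) :
    (pauliString u v).conjTranspose = pauliSign u v • pauliString u v := by
  rw [pauliString_eq, tensorProd_conjTranspose, pauliSign, ← tensorProd_smul]
  simp only [qubitPauli_conjTranspose]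

variable [DecidableEq ι]

theorem pauliString_mul (u v u' v' : ι → Fin 2) :
    pauliString u v * pauliString u' v' =
      pauliSign v u' • pauliString (u + u') (v + v') := by
  rw [pauliString_eq, pauliString_eq, tensorProd_mul, pauliSign, pauliString_eq, ← tensorProd_smul]
  simp only [qubitPauli_mul, Pi.add_apply]

theorem pauliString_zero : pauliString (0 : ι → Fin 2) 0 = 1 := by
  rw [pauliString_eq]
  simp only [Pi.zero_apply, qubitPauli_zero, tensorProd_one]

theorem fin_two_add_self (u : ι → Fin 2) : u + u = 0 := by
  ext i
  simp only [Pi.add_apply, Pi.zero_apply]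
  generalize u i = a
  fin_cases a <;> rfl

theorem pauliString_mul_conjTranspose (u v : ι → Fin 2) :
    pauliString u v * (pauliString u v).conjTranspose = 1 := by
  rw [pauliString_conjTranspose, Matrix.mul_smul, pauliString_mul, smul_smul, fin_two_add_self,
    fin_two_add_self, pauliString_zero]
  have : pauliSign v u = pauliSign u v := by simp only [pauliSign, mul_comm]
  rw [this, pauliSign_mul_self, one_smul]

theorem trace_pauliString (u v : ι → Fin 2) :
    (pauliString u v).trace = if u = 0 ∧ v = 0 then (2 : ℂ) ^ Fintype.card ι else 0 := by
  rw [pauliString_eq, trace_tensorProd]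
  simp only [trace_qubitPauli, Finset.prod_ite_zero, Finset.mem_univ, true_imp_iff, forall_and,
    Finset.prod_const, Finset.card_univ]
  simp only [funext_iff, Pi.zero_apply]

/-- Completeness of the Pauli strings. -/
theorem sum_pauliString (x y x' y' : ι → Fin 2) :
    ∑ w : (ι → Fin 2) × (ι → Fin 2),
        pauliString w.1 w.2 x y * star (pauliString w.1 w.2 x' y') =
      if x = x' ∧ y = y' then (2 : ℂ) ^ Fintype.card ι else 0 := by
  rw [← Equiv.sum_comp (Equiv.arrowProdEquivProdArrow ι (fun _ => Fin 2) (fun _ => Fin 2))]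
  have h : ∀ f : ι → Fin 2 × Fin 2,
      pauliString (fun i => (f i).1) (fun i => (f i).2) x y *
        star (pauliString (fun i => (f i).1) (fun i => (f i).2) x' y') =
      ∏ i, (qubitPauli (f i).1 (f i).2 (x i) (y i) *
        star (qubitPauli (f i).1 (f i).2 (x' i) (y' i))) := fun f => by
    rw [pauliString_eq, tensorProd_apply, tensorProd_apply, star_prod, Finset.prod_mul_distrib]
  refine (Finset.sum_congr rfl fun f _ => h f).trans ?_
  rw [← Fintype.prod_sum fun i (w : Fin 2 × Fin 2) =>
    qubitPauli w.1 w.2 (x i) (y i) * star (qubitPauli w.1 w.2 (x' i) (y' i))]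
  simp only [sum_qubitPauli, Finset.prod_ite_zero, Finset.mem_univ, true_imp_iff, forall_and,
    Finset.prod_const, Finset.card_univ]
  simp only [funext_iff]

theorem sum_trace_smul_pauliString (M : Matrix (ι → Fin 2) (ι → Fin 2) ℂ) :
    ∑ w : (ι → Fin 2) × (ι → Fin 2),
      ((pauliString w.1 w.2).conjTranspose * M).trace • pauliString w.1 w.2 =
      (2 : ℂ) ^ Fintype.card ι • M := by
  ext x y
  simp only [Matrix.sum_apply, Matrix.smul_apply, smul_eq_mul, Matrix.trace, Matrix.diag_apply,
    Matrix.mul_apply, Finset.sum_mul, Matrix.conjTranspose_apply]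
  rw [Finset.sum_comm]
  have h : ∀ a b : ι → Fin 2, ∑ w : (ι → Fin 2) × (ι → Fin 2),
      star (pauliString w.1 w.2 b a) * M b a * pauliString w.1 w.2 x y =
      (if x = b ∧ y = a then (2 : ℂ) ^ Fintype.card ι else 0) * M b a := fun a b => by
    rw [← sum_pauliString, Finset.sum_mul]
    exact Finset.sum_congr rfl fun w _ => by ring
  refine (Finset.sum_congr rfl fun a _ => Finset.sum_comm.trans
    (Finset.sum_congr rfl fun b _ => h a b)).trans ?_
  simp [ite_and]

theorem norm_trace_conjTranspose_pauliString_mul (u v : ι → Fin 2)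
    (M : Matrix (ι → Fin 2) (ι → Fin 2) ℂ) :
    ‖((pauliString u v).conjTranspose * M).trace‖ = ‖(pauliString u v * M).trace‖ := by
  rw [pauliString_conjTranspose, Matrix.smul_mul, Matrix.trace_smul, norm_smul]
  rcases pauliSign_eq_one_or u v with h | h <;> simp [h]

/-- Parseval's identity for the Pauli expansion. -/
theorem sum_norm_trace_pauliString_sq (M : Matrix (ι → Fin 2) (ι → Fin 2) ℂ) :
    ((∑ w : (ι → Fin 2) × (ι → Fin 2), ‖(pauliString w.1 w.2 * M).trace‖ ^ 2 : ℝ) : ℂ) =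
      (2 : ℂ) ^ Fintype.card ι * (M.conjTranspose * M).trace := by
  have h := congrArg (fun A => (M.conjTranspose * A).trace) (sum_trace_smul_pauliString M)
  simp only [Finset.mul_sum, Matrix.mul_smul, Matrix.trace_sum, Matrix.trace_smul,
    smul_eq_mul] at h
  rw [← h, Complex.ofReal_sum]
  refine Finset.sum_congr rfl fun w _ => ?_
  have h2 : (M.conjTranspose * pauliString w.1 w.2).trace =
      star ((pauliString w.1 w.2).conjTranspose * M).trace := by
    rw [← Matrix.trace_conjTranspose, Matrix.conjTranspose_mul, Matrix.conjTranspose_conjTranspose]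
  rw [h2, ← norm_trace_conjTranspose_pauliString_mul, Complex.star_def, Complex.mul_conj,
    Complex.normSq_eq_norm_sq]

end Pauli

/-! ### Operators supported on a set of qubits -/

section Support

variable {ι : Type*} [Fintype ι] [DecidableEq ι]

/-- `M` acts trivially outside `S`: it commutes with all Pauli strings supported outside `S`. -/
def SupportedOn (S : Set ι) (M : Matrix (ι → Fin 2) (ι → Fin 2) ℂ) : Prop :=
  ∀ u v : ι → Fin 2, (∀ i ∈ S, u i = 0 ∧ v i = 0) → Commute M (pauliString u v)

variable {S T : Set ι} {M M' : Matrix (ι → Fin 2) (ι → Fin 2) ℂ}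

theorem SupportedOn.mono (h : SupportedOn S M) (hST : S ⊆ T) : SupportedOn T M :=
  fun u v huv => h u v fun i hi => huv i (hST hi)

theorem SupportedOn.mul (h : SupportedOn S M) (h' : SupportedOn S M') : SupportedOn S (M * M') :=
  fun u v huv => (h u v huv).mul_left (h' u v huv)

theorem SupportedOn.conjTranspose (h : SupportedOn S M) : SupportedOn S M.conjTranspose := by
  intro u v huv
  have h1 := congrArg Matrix.conjTranspose (h u v huv).eq
  rw [Matrix.conjTranspose_mul, Matrix.conjTranspose_mul, pauliString_conjTranspose,
    Matrix.smul_mul, Matrix.mul_smul] at h1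
  have h2 := congrArg (pauliSign u v • ·) h1
  simp only [smul_smul, pauliSign_mul_self, one_smul] at h2
  exact h2.symm

theorem trace_mul_eq_zero_of_anticommute {m : Type*} [Fintype m] [DecidableEq m]
    {P R M : Matrix m m ℂ} (hR : R * R.conjTranspose = 1) (hPR : P * R = -(R * P))
    (hM : Commute M R) : (P * M).trace = 0 := by
  have h : (P * M).trace = -(P * M).trace := by
    calc (P * M).trace = (P * M * (R * R.conjTranspose)).trace := by rw [hR, mul_one]
      _ = (P * R * M * R.conjTranspose).trace := by
        rw [← mul_assoc, mul_assoc P M R, hM.eq, mul_assoc P R M]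
      _ = -((R * P * M) * R.conjTranspose).trace := by
        rw [hPR, Matrix.neg_mul, Matrix.neg_mul, Matrix.trace_neg]
      _ = -(P * M).trace := by
        rw [Matrix.trace_mul_comm, mul_assoc R, ← mul_assoc, mul_eq_one_comm.1 hR, one_mul]
  linear_combination h / 2

/-- A Pauli string acting nontrivially at `i` anticommutes with `Z_i` or with `X_i`, while `M`
commutes with both because `i` is outside `S`. -/
theorem SupportedOn.trace_eq_zero (h : SupportedOn S M) {u v : ι → Fin 2} {i : ι} (hi : i ∉ S)
    (huv : ¬ (u i = 0 ∧ v i = 0)) : (pauliString u v * M).trace = 0 := by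
  have hS : ∀ j ∈ S, j ≠ i := fun j hj hji => hi (hji ▸ hj)
  have hcase : v i = 1 ∨ (v i = 0 ∧ u i = 1) := by
    revert huv
    generalize u i = a
    generalize v i = b
    revert a b
    decide
  have hsign : ∀ w : ι → Fin 2, w i = 1 → pauliSign w (Pi.single i 1) = -1 := fun w hw => by
    rw [pauliSign, Fintype.prod_eq_single i fun j hj => by simp [hj]]
    simp [hw]
  have hsign' : ∀ w : ι → Fin 2, w i = 1 → pauliSign (Pi.single i 1) w = -1 := fun w hw => by
    rw [pauliSign, Fintype.prod_eq_single i fun j hj => by simp [hj]]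
    simp [hw]
  have h0 : ∀ w : ι → Fin 2, pauliSign w 0 = 1 := fun w => pauliSign_eq_one fun _ => Or.inr rfl
  have h0' : ∀ w : ι → Fin 2, pauliSign 0 w = 1 := fun w => pauliSign_eq_one fun _ => Or.inl rfl
  rcases hcase with hv | ⟨hv, hu⟩
  · refine trace_mul_eq_zero_of_anticommute (R := pauliString (Pi.single i 1) 0)
      (pauliString_mul_conjTranspose _ _) ?_ (h _ _ fun j hj => by simp [hS j hj])
    rw [pauliString_mul, pauliString_mul, hsign v hv, h0', add_comm u, add_comm v]
    simp
  · refine trace_mul_eq_zero_of_anticommute (R := pauliString 0 (Pi.single i 1))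
      (pauliString_mul_conjTranspose _ _) ?_ (h _ _ fun j hj => by simp [hS j hj])
    rw [pauliString_mul, pauliString_mul, hsign' u hu, h0, add_comm u, add_comm v]
    simp

/-- Expand `M'` in Pauli strings. Those acting nontrivially somewhere in `S` have zero coefficient,
and the others commute with `M` by definition. -/
theorem SupportedOn.commute (h : SupportedOn S M) (h' : SupportedOn T M') (hST : Disjoint S T) :
    Commute M M' := by
  have h2 : (2 : ℂ) ^ Fintype.card ι ≠ 0 := by positivity
  have hM' : M' = ((2 : ℂ) ^ Fintype.card ι)⁻¹ • ∑ w : (ι → Fin 2) × (ι → Fin 2),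
      ((pauliString w.1 w.2).conjTranspose * M').trace • pauliString w.1 w.2 := by
    rw [sum_trace_smul_pauliString, smul_smul, inv_mul_cancel₀ h2, one_smul]
  rw [hM']
  refine (Commute.sum_right _ _ _ fun w _ => ?_).smul_right _
  by_cases hw : ∀ i ∈ S, w.1 i = 0 ∧ w.2 i = 0
  · exact (h _ _ hw).smul_right _
  · push Not at hw
    obtain ⟨i, hi, hwi⟩ := hw
    rw [pauliString_conjTranspose, Matrix.smul_mul, Matrix.trace_smul,
      h'.trace_eq_zero (Set.disjoint_left.1 hST hi) (fun h => hwi h.1 h.2), smul_zero, zero_smul]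
    exact Commute.zero_right _

/-- Expanded in matrix units on `S`, the gate is a combination of product operators equal to `1` off
`S`. A Pauli string supported off `S` is `1` on `S`, so the two commute factor by factor. -/
theorem ActsOn.supportedOn {S : Finset ι} {G : Matrix.unitaryGroup (ι → Fin 2) ℂ}
    (h : ActsOn S G) : SupportedOn (S : Set ι) (G : Matrix (ι → Fin 2) (ι → Fin 2) ℂ) := by
  obtain ⟨g, hg⟩ := h
  have hG : (G : Matrix (ι → Fin 2) (ι → Fin 2) ℂ) = ∑ a : S → Fin 2, ∑ b : S → Fin 2,
      g a b • tensorProd fun i => if h : i ∈ S then Matrix.single (a ⟨i, h⟩) (b ⟨i, h⟩) 1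
        else 1 := by
    ext x y
    have hprod : ∀ a b : S → Fin 2, (tensorProd fun i => if h : i ∈ S then
        Matrix.single (a ⟨i, h⟩) (b ⟨i, h⟩) (1 : ℂ) else 1) x y =
        if (∀ i, i ∉ S → x i = y i) ∧ a = (fun i : S => x i) ∧
          b = (fun i : S => y i) then 1 else 0 := by
      intro a b
      have h1 : ∀ i, (if h : i ∈ S then Matrix.single (a ⟨i, h⟩) (b ⟨i, h⟩) (1 : ℂ) else 1)
          (x i) (y i) = if (i ∉ S → x i = y i) ∧
            ∀ h : i ∈ S, a ⟨i, h⟩ = x i ∧ b ⟨i, h⟩ = y i then 1 else 0 := by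
        intro i
        by_cases hi : i ∈ S
        · simp [hi, Matrix.single_apply]
        · simp [hi, Matrix.one_apply]
      simp only [tensorProd_apply, h1, Finset.prod_ite_zero, Finset.mem_univ, true_imp_iff,
        Finset.prod_const_one, forall_and, funext_iff, Subtype.forall]
    rw [hg, Matrix.sum_apply]
    simp only [Matrix.sum_apply, Matrix.smul_apply, hprod, smul_eq_mul]
    by_cases hxy : ∀ i, i ∉ S → x i = y i
    · rw [if_pos hxy, Fintype.sum_eq_single fun i : S => x i, Fintype.sum_eq_single fun i : S => y i]
      · rw [if_pos ⟨hxy, rfl, rfl⟩, mul_one]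
      · intro b hb
        simp [hb]
      · intro a ha
        simp [ha]
    · simp [hxy]
  intro u v huv
  rw [hG]
  refine Commute.sum_left _ _ _ fun a _ => Commute.sum_left _ _ _ fun b _ => Commute.smul_left ?_ _
  rw [commute_iff_eq, pauliString_eq, tensorProd_mul, tensorProd_mul]
  congr 1
  ext1 i
  by_cases hi : i ∈ S
  · rw [(huv i hi).1, (huv i hi).2, qubitPauli_zero, mul_one, one_mul]
  · rw [dif_neg hi, mul_one, one_mul]

end Support

/-! ### Light cones of local circuits -/

section LightCone

variable {ι : Type*} [Fintype ι] [DecidableEq ι]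

/-- Heisenberg evolution `U M U†`. -/
def heisenberg (U : Matrix.unitaryGroup (ι → Fin 2) ℂ) (M : Matrix (ι → Fin 2) (ι → Fin 2) ℂ) :
    Matrix (ι → Fin 2) (ι → Fin 2) ℂ :=
  (U : Matrix (ι → Fin 2) (ι → Fin 2) ℂ) * M *
    (U : Matrix (ι → Fin 2) (ι → Fin 2) ℂ).conjTranspose

theorem heisenberg_mul (U V : Matrix.unitaryGroup (ι → Fin 2) ℂ)
    (M : Matrix (ι → Fin 2) (ι → Fin 2) ℂ) :
    heisenberg (U * V) M = heisenberg U (heisenberg V M) := by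
  simp only [heisenberg, Submonoid.coe_mul, Matrix.conjTranspose_mul, mul_assoc]

theorem heisenberg_one (M : Matrix (ι → Fin 2) (ι → Fin 2) ℂ) : heisenberg 1 M = M := by
  simp [heisenberg]

theorem unitary_mul_conjTranspose {n : Type*} [Fintype n] [DecidableEq n]
    (U : Matrix.unitaryGroup n ℂ) : (U : Matrix n n ℂ) * (U : Matrix n n ℂ).conjTranspose = 1 :=
  Matrix.mem_unitaryGroup_iff.1 U.2

theorem unitary_conjTranspose_mul {n : Type*} [Fintype n] [DecidableEq n]
    (U : Matrix.unitaryGroup n ℂ) : (U : Matrix n n ℂ).conjTranspose * (U : Matrix n n ℂ) = 1 :=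
  Matrix.mem_unitaryGroup_iff'.1 U.2

theorem heisenberg_of_commute {U : Matrix.unitaryGroup (ι → Fin 2) ℂ}
    {M : Matrix (ι → Fin 2) (ι → Fin 2) ℂ}
    (h : Commute M (U : Matrix (ι → Fin 2) (ι → Fin 2) ℂ)) : heisenberg U M = M := by
  rw [heisenberg, ← h.eq, mul_assoc, unitary_mul_conjTranspose, mul_one]

/-- A product of gates with disjoint supports enlarges the support `B` of an operator only by the
supports of the gates that meet `B`. -/
theorem supportedOn_heisenberg_prod {B : Set ι} {M : Matrix (ι → Fin 2) (ι → Fin 2) ℂ}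
    (hM : SupportedOn B M) {m : ℕ} (S : Fin m → Finset ι)
    (G : Fin m → Matrix.unitaryGroup (ι → Fin 2) ℂ)
    (hS : ∀ a b, a ≠ b → Disjoint (S a) (S b)) (hG : ∀ a, ActsOn (S a) (G a)) :
    SupportedOn (B ∪ {i | ∃ a, ¬ Disjoint (S a : Set ι) B ∧ i ∈ S a})
      (heisenberg (List.ofFn G).prod M) := by
  induction m with
  | zero =>
    rw [List.ofFn_zero, List.prod_nil, heisenberg_one]
    exact hM.mono Set.subset_union_left
  | succ m ih =>
    have h := ih (fun a => S a.succ) (fun a => G a.succ)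
      (fun a b hab => hS _ _ fun h => hab (Fin.succ_injective _ h)) fun a => hG _
    rw [List.ofFn_succ, List.prod_cons, heisenberg_mul]
    have hsub : B ∪ {i | ∃ a : Fin m, ¬ Disjoint (S a.succ : Set ι) B ∧ i ∈ S a.succ} ⊆
        B ∪ {i | ∃ a, ¬ Disjoint (S a : Set ι) B ∧ i ∈ S a} := by
      rintro i (hi | ⟨a, ha, hi⟩)
      · exact Or.inl hi
      · exact Or.inr ⟨a.succ, ha, hi⟩
    -- A gate missing `B` also misses the gates already absorbed, so it cancels against its adjoint.
    -- A gate meeting `B` has its support inside the enlarged set.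
    by_cases h0 : Disjoint (S 0 : Set ι) B
    · rw [heisenberg_of_commute (h.commute (hG 0).supportedOn ?_)]
      · exact h.mono hsub
      · refine (Set.disjoint_union_left.2 ⟨h0.symm, Set.disjoint_left.2 ?_⟩)
        rintro i ⟨a, -, hi⟩ hi0
        exact Finset.disjoint_left.1 (hS a.succ 0 (Fin.succ_ne_zero a)) hi hi0
    · have h1 : SupportedOn (B ∪ {i | ∃ a, ¬ Disjoint (S a : Set ι) B ∧ i ∈ S a})
          (G 0 : Matrix (ι → Fin 2) (ι → Fin 2) ℂ) :=
        (hG 0).supportedOn.mono fun i hi => Or.inr ⟨0, h0, hi⟩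
      exact (h1.mul (h.mono hsub)).mul h1.conjTranspose

variable {d L : ℕ}

/-- The sites within distance `t` of `x` in every coordinate (modulo `L`). -/
def latticeBox (x : Fin d → Fin L) (t : ℕ) : Finset (Fin d → Fin L) :=
  Fintype.piFinset fun j => Finset.univ.filter fun c : Fin L =>
    ∃ m ∈ Finset.Icc (-(t : ℤ)) t, (c : ℤ) = (x j + m) % L

theorem mem_latticeBox {x y : Fin d → Fin L} {t : ℕ} :
    y ∈ latticeBox x t ↔ ∀ j, ∃ m : ℤ, (-(t : ℤ) ≤ m ∧ m ≤ t) ∧ (y j : ℤ) = (x j + m) % L := by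
  simp only [latticeBox, Fintype.mem_piFinset, Finset.mem_filter, Finset.mem_univ, true_and,
    Finset.mem_Icc]

theorem card_latticeBox_le (x : Fin d → Fin L) (t : ℕ) :
    (latticeBox x t).card ≤ (2 * t + 1) ^ d := by
  rw [latticeBox, Fintype.card_piFinset]
  refine (Finset.prod_le_pow_card _ _ (2 * t + 1) fun j _ => ?_).trans (by simp)
  have hinj : Function.Injective fun c : Fin L => (c : ℤ) := fun a b h =>
    Fin.ext (Int.ofNat_inj.1 h)
  rw [← Finset.card_image_of_injective _ hinj]
  have hsub : (Finset.univ.filter fun c : Fin L =>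
      ∃ m ∈ Finset.Icc (-(t : ℤ)) t, (c : ℤ) = (x j + m) % L).image (fun c : Fin L => (c : ℤ)) ⊆
      (Finset.Icc (-(t : ℤ)) t).image fun m => ((x j : ℤ) + m) % L := by
    intro z hz
    simp only [Finset.mem_image, Finset.mem_filter, Finset.mem_univ, true_and] at hz ⊢
    obtain ⟨c, ⟨m, hm, hc⟩, rfl⟩ := hz
    exact ⟨m, hm, hc.symm⟩
  refine (Finset.card_le_card hsub).trans (Finset.card_image_le.trans ?_)
  rw [Int.card_Icc]
  omega

theorem self_mem_latticeBox_zero (x : Fin d → Fin L) : x ∈ latticeBox x 0 :=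
  mem_latticeBox.2 fun j => ⟨0, by simp, by
    rw [add_zero, Int.emod_eq_of_lt (by positivity) (by exact_mod_cast (x j).2)]⟩

theorem latticeBox_subset_succ (x : Fin d → Fin L) (t : ℕ) :
    latticeBox x t ⊆ latticeBox x (t + 1) := fun y hy => by
  rw [mem_latticeBox] at hy ⊢
  intro j
  obtain ⟨m, hm, h⟩ := hy j
  exact ⟨m, by push_cast; omega, h⟩

theorem IsSucc.mem_latticeBox_succ {x y z : Fin d → Fin L} {t : ℕ} (h : IsSucc y z) :
    (y ∈ latticeBox x t → z ∈ latticeBox x (t + 1)) ∧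
    (z ∈ latticeBox x t → y ∈ latticeBox x (t + 1)) := by
  obtain ⟨i, hi, hne⟩ := h
  have hi' : (z i : ℤ) = ((y i : ℤ) + 1) % L := by exact_mod_cast hi
  constructor
  · intro hy
    have hy' := latticeBox_subset_succ x t hy
    rw [mem_latticeBox] at hy hy' ⊢
    intro j
    rcases eq_or_ne j i with rfl | hj
    · obtain ⟨m, hm, h⟩ := hy j
      refine ⟨m + 1, by push_cast; omega, ?_⟩
      rw [hi', h, Int.emod_add_emod, add_assoc]
    · rw [hne j hj]
      exact hy' j
  · intro hz
    have hz' := latticeBox_subset_succ x t hz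
    rw [mem_latticeBox] at hz hz' ⊢
    intro j
    rcases eq_or_ne j i with rfl | hj
    · obtain ⟨m, hm, h⟩ := hz j
      refine ⟨m - 1, by push_cast; omega, ?_⟩
      have h1 : (y j : ℤ) = (y j : ℤ) % L :=
        (Int.emod_eq_of_lt (by positivity) (by exact_mod_cast (y j).2)).symm
      have h2 : ((y j : ℤ) + 1) % L = (x j + m) % L := by rw [← hi', h]
      have h3 : ((y j : ℤ) + 1 - 1) % L = (x j + m - 1) % L := Int.ModEq.sub_right 1 h2
      rw [h1, ← add_sub_assoc, ← h3, add_sub_cancel_right]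
    · rw [← hne j hj]
      exact hz' j

theorem IsGateSupport.subset_latticeBox_succ {S : Finset (Fin d → Fin L)} (hS : IsGateSupport S)
    {x : Fin d → Fin L} {t : ℕ} (h : ¬ Disjoint S (latticeBox x t)) :
    S ⊆ latticeBox x (t + 1) := by
  rw [Finset.not_disjoint_iff] at h
  obtain ⟨w, hwS, hw⟩ := h
  have hw' := latticeBox_subset_succ x t hw
  rcases hS with ⟨y, rfl⟩ | ⟨y, z, hyz, rfl⟩
  · rw [Finset.mem_singleton] at hwS
    rw [Finset.singleton_subset_iff, ← hwS]
    exact hw'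
  · rw [Finset.insert_subset_iff, Finset.singleton_subset_iff]
    rw [Finset.mem_insert, Finset.mem_singleton] at hwS
    rcases hwS with rfl | rfl
    · exact ⟨hw', hyz.mem_latticeBox_succ.1 hw⟩
    · exact ⟨hyz.mem_latticeBox_succ.2 hw, hw'⟩

theorem IsLayer.supportedOn_heisenberg {W : Matrix.unitaryGroup ((Fin d → Fin L) → Fin 2) ℂ}
    (hW : IsLayer W) {x : Fin d → Fin L} {t : ℕ}
    {M : Matrix ((Fin d → Fin L) → Fin 2) ((Fin d → Fin L) → Fin 2) ℂ}
    (hM : SupportedOn (latticeBox x t : Set (Fin d → Fin L)) M) :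
    SupportedOn (latticeBox x (t + 1) : Set (Fin d → Fin L)) (heisenberg W M) := by
  obtain ⟨m, S, G, hS, hdisj, hG, rfl⟩ := hW
  refine (supportedOn_heisenberg_prod hM S G hdisj hG).mono ?_
  rintro i (hi | ⟨a, ha, hi⟩)
  · exact latticeBox_subset_succ x t hi
  · exact (hS a).subset_latticeBox_succ (fun h => ha (Finset.disjoint_coe.2 h)) hi

theorem IsLocalCircuit.supportedOn_heisenberg {t : ℕ}
    {U : Matrix.unitaryGroup ((Fin d → Fin L) → Fin 2) ℂ} (hU : IsLocalCircuit t U)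
    {x : Fin d → Fin L} {M : Matrix ((Fin d → Fin L) → Fin 2) ((Fin d → Fin L) → Fin 2) ℂ}
    (hM : SupportedOn {x} M) :
    SupportedOn (latticeBox x t : Set (Fin d → Fin L)) (heisenberg U M) := by
  obtain ⟨W, hW, rfl⟩ := hU
  induction t with
  | zero =>
    rw [List.ofFn_zero, List.prod_nil, heisenberg_one]
    exact hM.mono (Set.singleton_subset_iff.2 (self_mem_latticeBox_zero x))
  | succ t ih =>
    rw [List.ofFn_succ, List.prod_cons, heisenberg_mul]
    exact (hW 0).supportedOn_heisenberg (ih (fun a => W a.succ) fun a => hW _)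

end LightCone

/-! ### The fourth moment of Pauli correlations -/

section PauliMoment

variable {ι : Type*} [Fintype ι] [DecidableEq ι]

/-- `∑ |tr(P U Q U†)|^4`, summed over all Pauli strings `P` and `Q`. -/
def pauliFourthMoment (U : Matrix.unitaryGroup (ι → Fin 2) ℂ) : ℝ :=
  ∑ w : (ι → Fin 2) × (ι → Fin 2), ∑ w' : (ι → Fin 2) × (ι → Fin 2),
    ‖(pauliString w.1 w.2 * heisenberg U (pauliString w'.1 w'.2)).trace‖ ^ 4

/-- By Parseval the squared coefficients sum to `D²`, and at most `4^|S|` of them are nonzero.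
Cauchy–Schwarz bounds the sum of their squares from below. -/
theorem sum_norm_trace_pow_four_ge {S : Finset ι} {M : Matrix (ι → Fin 2) (ι → Fin 2) ℂ}
    (hM : SupportedOn (S : Set ι) M) (hM1 : M.conjTranspose * M = 1) :
    ((2 : ℝ) ^ Fintype.card ι) ^ 4 ≤ (4 : ℝ) ^ S.card *
      ∑ w : (ι → Fin 2) × (ι → Fin 2), ‖(pauliString w.1 w.2 * M).trace‖ ^ 4 := by
  set K : Finset ((ι → Fin 2) × (ι → Fin 2)) :=
    Finset.univ.filter fun w => ∀ i, i ∉ S → w.1 i = 0 ∧ w.2 i = 0 with hK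
  have hcard : K.card ≤ 4 ^ S.card := by
    have h4 : (4 : ℕ) ^ S.card = Fintype.card (S → Fin 2 × Fin 2) := by simp
    rw [h4, ← Finset.card_univ]
    refine Finset.card_le_card_of_injOn (fun w i => (w.1 i, w.2 i)) (fun _ _ => Finset.mem_univ _) ?_
    intro w hw w' hw' h
    rw [Finset.mem_coe, hK, Finset.mem_filter] at hw hw'
    have : ∀ i, w.1 i = w'.1 i ∧ w.2 i = w'.2 i := fun i => by
      by_cases hi : i ∈ S
      · exact Prod.ext_iff.1 (congrFun h ⟨i, hi⟩)
      · rw [(hw.2 i hi).1, (hw.2 i hi).2, (hw'.2 i hi).1, (hw'.2 i hi).2]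
        exact ⟨rfl, rfl⟩
    exact Prod.ext (funext fun i => (this i).1) (funext fun i => (this i).2)
  have hpars : ∑ w : (ι → Fin 2) × (ι → Fin 2), ‖(pauliString w.1 w.2 * M).trace‖ ^ 2 =
      ((2 : ℝ) ^ Fintype.card ι) ^ 2 := by
    have h := sum_norm_trace_pauliString_sq M
    rw [hM1, Matrix.trace_one] at h
    have h2 : ((Fintype.card (ι → Fin 2) : ℕ) : ℂ) = (2 : ℂ) ^ Fintype.card ι := by simp
    rw [h2, ← sq] at h
    exact_mod_cast h
  have hK2 : ∑ w ∈ K, ‖(pauliString w.1 w.2 * M).trace‖ ^ 2 = ((2 : ℝ) ^ Fintype.card ι) ^ 2 := by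
    rw [← hpars]
    refine Finset.sum_subset (Finset.subset_univ _) fun w _ hw => ?_
    have : ¬ ∀ i, i ∉ S → w.1 i = 0 ∧ w.2 i = 0 := fun h =>
      hw (Finset.mem_filter.2 ⟨Finset.mem_univ _, h⟩)
    push Not at this
    obtain ⟨i, hi, hwi⟩ := this
    rw [hM.trace_eq_zero (by simpa using hi) fun h => hwi h.1 h.2]
    simp
  have hcs := sq_sum_le_card_mul_sum_sq (s := K)
    (f := fun w => ‖(pauliString w.1 w.2 * M).trace‖ ^ 2)
  rw [hK2] at hcs
  calc ((2 : ℝ) ^ Fintype.card ι) ^ 4 = (((2 : ℝ) ^ Fintype.card ι) ^ 2) ^ 2 := by ring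
    _ ≤ K.card * ∑ w ∈ K, (‖(pauliString w.1 w.2 * M).trace‖ ^ 2) ^ 2 := hcs
    _ ≤ (4 : ℝ) ^ S.card *
        ∑ w : (ι → Fin 2) × (ι → Fin 2), ‖(pauliString w.1 w.2 * M).trace‖ ^ 4 := by
      refine mul_le_mul (by exact_mod_cast hcard) ?_
        (Finset.sum_nonneg fun _ _ => by positivity) (by positivity)
      simp only [← pow_mul]
      exact Finset.sum_le_sum_of_subset_of_nonneg (Finset.subset_univ _)
        fun _ _ _ => by positivity

theorem supportedOn_pauliString_single (x : ι) :
    SupportedOn {x} (pauliString (Pi.single x 1) 0) := by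
  intro u v h
  obtain ⟨hu, hv⟩ := h x rfl
  rw [commute_iff_eq, pauliString_mul, pauliString_mul, add_comm u, add_comm v,
    pauliSign_eq_one (u := 0) fun i => Or.inl rfl, pauliSign_eq_one fun i => ?_]
  rcases eq_or_ne i x with rfl | hi
  · exact Or.inl hv
  · exact Or.inr (Pi.single_eq_of_ne hi _)

theorem heisenberg_conjTranspose_mul (U : Matrix.unitaryGroup (ι → Fin 2) ℂ)
    {M : Matrix (ι → Fin 2) (ι → Fin 2) ℂ} (hM : M.conjTranspose * M = 1) :
    (heisenberg U M).conjTranspose * heisenberg U M = 1 := by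
  have h1 := unitary_conjTranspose_mul U
  have h2 := unitary_mul_conjTranspose U
  rw [heisenberg]
  generalize (U : Matrix (ι → Fin 2) (ι → Fin 2) ℂ) = V at h1 h2 ⊢
  rw [Matrix.conjTranspose_mul, Matrix.conjTranspose_mul, Matrix.conjTranspose_conjTranspose,
    mul_assoc, mul_assoc, mul_assoc, ← mul_assoc V.conjTranspose V, h1, one_mul,
    ← mul_assoc M.conjTranspose, hM, one_mul, h2]

theorem sum_pauli_single_le (f : (ι → Fin 2) × (ι → Fin 2) → ℝ) (hf : ∀ w, 0 ≤ f w) :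
    ∑ x : ι, f (Pi.single x 1, 0) ≤ ∑ w, f w := by
  have hinj : Function.Injective fun x : ι =>
      ((Pi.single x 1, 0) : (ι → Fin 2) × (ι → Fin 2)) := by
    intro x y hxy
    have h1 := congrFun (Prod.ext_iff.1 hxy).1 x
    by_contra hne
    simp [Pi.single_eq_of_ne hne] at h1
  exact (Finset.sum_map Finset.univ ⟨_, hinj⟩ f).symm.trans_le
    (Finset.sum_le_sum_of_subset_of_nonneg (Finset.subset_univ _) fun _ _ _ => hf _)

/-- Keep only the terms with `Q = Z_x`, one for each site `x`. The light cone of `x` has at most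
`(2t+1)^d` sites. -/
theorem IsLocalCircuit.pauliFourthMoment_ge {d L t : ℕ}
    {U : Matrix.unitaryGroup ((Fin d → Fin L) → Fin 2) ℂ} (hU : IsLocalCircuit t U) :
    ((2 : ℝ) ^ (L ^ d)) ^ 4 * (L : ℝ) ^ d ≤ (4 : ℝ) ^ ((2 * t + 1) ^ d) * pauliFourthMoment U := by
  have hcard : Fintype.card (Fin d → Fin L) = L ^ d := by simp
  let f : ((Fin d → Fin L) → Fin 2) × ((Fin d → Fin L) → Fin 2) → ℝ := fun w' =>
    ∑ w : ((Fin d → Fin L) → Fin 2) × ((Fin d → Fin L) → Fin 2),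
      ‖(pauliString w.1 w.2 * heisenberg U (pauliString w'.1 w'.2)).trace‖ ^ 4
  have hf : ∀ w', 0 ≤ f w' := fun w' => Finset.sum_nonneg fun _ _ => by positivity
  have hx : ∀ x : Fin d → Fin L, ((2 : ℝ) ^ (L ^ d)) ^ 4 ≤
      (4 : ℝ) ^ ((2 * t + 1) ^ d) * f (Pi.single x 1, 0) := by
    intro x
    have h1 : ((2 : ℝ) ^ Fintype.card (Fin d → Fin L)) ^ 4 ≤
        (4 : ℝ) ^ (latticeBox x t).card * f (Pi.single x 1, 0) := sum_norm_trace_pow_four_ge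
      (hU.supportedOn_heisenberg (supportedOn_pauliString_single x))
      (heisenberg_conjTranspose_mul U (mul_eq_one_comm.1 (pauliString_mul_conjTranspose _ _)))
    rw [hcard] at h1
    have h2 : (4 : ℝ) ^ (latticeBox x t).card ≤ (4 : ℝ) ^ ((2 * t + 1) ^ d) :=
      pow_le_pow_right₀ (by norm_num) (card_latticeBox_le x t)
    exact h1.trans (mul_le_mul_of_nonneg_right h2 (hf (Pi.single x 1, 0)))
  have hsum : pauliFourthMoment U = ∑ w', f w' := Finset.sum_comm
  calc ((2 : ℝ) ^ (L ^ d)) ^ 4 * (L : ℝ) ^ d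
      = ∑ _x : Fin d → Fin L, ((2 : ℝ) ^ (L ^ d)) ^ 4 := by
        rw [Finset.sum_const, Finset.card_univ, hcard, nsmul_eq_mul, mul_comm, Nat.cast_pow]
    _ ≤ ∑ x : Fin d → Fin L, (4 : ℝ) ^ ((2 * t + 1) ^ d) * f (Pi.single x 1, 0) :=
        Finset.sum_le_sum fun x _ => hx x
    _ ≤ (4 : ℝ) ^ ((2 * t + 1) ^ d) * pauliFourthMoment U := by
      rw [← Finset.mul_sum, hsum]
      exact mul_le_mul_of_nonneg_left (sum_pauli_single_le f hf) (by positivity)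

end PauliMoment

/-! ### Pauli averages in four tensor factors -/

section PadFour

variable {k : ℕ} {n : Type*} [Fintype n] [DecidableEq n]

/-- The operator `M^{⊗ 4} ⊗ I^{⊗ (k - 4)}`. -/
def padFour (k : ℕ) (M : Matrix n n ℂ) : Matrix (Fin k → n) (Fin k → n) ℂ :=
  tensorProd fun i : Fin k => if (i : ℕ) < 4 then M else 1

theorem prod_fin_ite_lt_four (hk : 4 ≤ k) (a b : ℂ) :
    ∏ i : Fin k, (if (i : ℕ) < 4 then a else b) = a ^ 4 * b ^ (k - 4) := by
  obtain ⟨m, rfl⟩ := Nat.exists_eq_add_of_le hk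
  rw [Fin.prod_univ_add]
  simp

theorem padFour_smul (hk : 4 ≤ k) (c : ℂ) (M : Matrix n n ℂ) :
    padFour k (c • M) = c ^ 4 • padFour k M := by
  have h := prod_fin_ite_lt_four hk c 1
  rw [one_pow, mul_one] at h
  rw [padFour, padFour, ← h, ← tensorProd_smul]
  congr 1
  ext1 i
  split_ifs <;> simp

theorem padFour_mul (M M' : Matrix n n ℂ) :
    padFour k M * padFour k M' = padFour k (M * M') := by
  rw [padFour, padFour, padFour, tensorProd_mul]
  congr 1
  ext1 i
  split_ifs <;> simp

theorem padFour_conjTranspose (M : Matrix n n ℂ) :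
    (padFour k M).conjTranspose = padFour k M.conjTranspose := by
  rw [padFour, padFour, tensorProd_conjTranspose]
  congr 1
  ext1 i
  split_ifs <;> simp

theorem trace_padFour (hk : 4 ≤ k) (M : Matrix n n ℂ) :
    (padFour k M).trace = M.trace ^ 4 * (Fintype.card n : ℂ) ^ (k - 4) := by
  rw [← prod_fin_ite_lt_four hk, padFour, trace_tensorProd]
  refine Finset.prod_congr rfl fun i _ => ?_
  split_ifs <;> simp

theorem conjTensorPow_padFour (U : Matrix.unitaryGroup n ℂ) (M : Matrix n n ℂ) :
    conjTensorPow k U (padFour k M) =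
      padFour k ((U : Matrix n n ℂ) * M * (U : Matrix n n ℂ).conjTranspose) := by
  rw [conjTensorPow, tensorPow_conjTranspose, tensorPow, tensorPow, padFour, padFour,
    tensorProd_mul, tensorProd_mul]
  congr 1
  ext1 i
  split_ifs
  · rfl
  · rw [mul_one, unitary_mul_conjTranspose]

theorem conjTensorPow_sum {J : Type*} (s : Finset J) (U : Matrix.unitaryGroup n ℂ)
    (A : J → Matrix (Fin k → n) (Fin k → n) ℂ) :
    conjTensorPow k U (∑ j ∈ s, A j) = ∑ j ∈ s, conjTensorPow k U (A j) := by
  simp only [conjTensorPow, Finset.mul_sum, Finset.sum_mul]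

/-- The inner `V₂` is absorbed by `A`. The outer `V₁^{⊗k}` commutes with `A` and cancels by
cyclicity of the trace. -/
theorem trace_mul_conjTensorPow_of_invariant {A : Matrix (Fin k → n) (Fin k → n) ℂ}
    {V₁ V₂ : Matrix.unitaryGroup n ℂ} (h₁ : conjTensorPow k V₁ A = A)
    (h₂ : conjTensorPow k V₂ A = A) (U : Matrix.unitaryGroup n ℂ) :
    (A * conjTensorPow k (V₁ * U * V₂) A).trace = (A * conjTensorPow k U A).trace := by
  have hU : conjTensorPow k (U * V₂) A = conjTensorPow k U A := by
    rw [conjTensorPow_mul, h₂, ← conjTensorPow]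
  rw [mul_assoc, conjTensorPow_mul, hU]
  have hT := tensorPow_unitary_conjTranspose_mul k V₁
  rw [conjTensorPow] at h₁
  generalize tensorPow k (V₁ : Matrix n n ℂ) = T at h₁ hT ⊢
  generalize conjTensorPow k U A = X
  have hc : A * T = T * A := by
    conv_lhs => rw [← h₁, mul_assoc, hT, mul_one]
  rw [← mul_assoc, ← mul_assoc, hc, Matrix.trace_mul_comm, ← mul_assoc, ← mul_assoc, hT, one_mul]

end PadFour

/-! ### The Pauli sum and its pairing with twirls -/

section PauliSum

variable {k : ℕ} {ι : Type*} [Fintype ι] [DecidableEq ι]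

/-- `∑ P, P^{⊗ 4} ⊗ I^{⊗ (k - 4)}`, summed over all Pauli strings. -/
def pauliSum (ι : Type*) [Fintype ι] [DecidableEq ι] (k : ℕ) :
    Matrix (Fin k → ι → Fin 2) (Fin k → ι → Fin 2) ℂ :=
  ∑ w : (ι → Fin 2) × (ι → Fin 2), padFour k (pauliString w.1 w.2)

theorem pauliSign_pow_four (u v : ι → Fin 2) : pauliSign u v ^ 4 = 1 := by
  rcases pauliSign_eq_one_or u v with h | h <;> rw [h] <;> norm_num

theorem pauliSum_conjTranspose (hk : 4 ≤ k) : (pauliSum ι k).conjTranspose = pauliSum ι k := by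
  rw [pauliSum, Matrix.conjTranspose_sum]
  refine Finset.sum_congr rfl fun w _ => ?_
  rw [padFour_conjTranspose, pauliString_conjTranspose, padFour_smul hk, pauliSign_pow_four,
    one_smul]

/-- Pauli strings are closed under multiplication up to sign, and the fourth tensor power kills the
sign. Multiplying by one summand thus permutes the summands. -/
theorem pauliSum_mul_self (hk : 4 ≤ k) : pauliSum ι k * pauliSum ι k =
    (Fintype.card ((ι → Fin 2) × (ι → Fin 2)) : ℂ) • pauliSum ι k := by
  have h : ∀ w : (ι → Fin 2) × (ι → Fin 2),
      padFour k (pauliString w.1 w.2) * pauliSum ι k = pauliSum ι k := fun w => by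
    rw [pauliSum, Finset.mul_sum, ← Equiv.sum_comp (Equiv.addLeft w) fun w' =>
      padFour k (pauliString w'.1 w'.2)]
    refine Finset.sum_congr rfl fun w' _ => ?_
    rw [padFour_mul, pauliString_mul, padFour_smul hk, pauliSign_pow_four, one_smul]
    rfl
  refine (Finset.sum_mul _ _ _).trans ?_
  rw [Finset.sum_congr rfl fun w _ => h w, Finset.sum_const, Finset.card_univ,
    ← Nat.cast_smul_eq_nsmul ℂ]

theorem pauliSum_posSemidef (hk : 4 ≤ k) : (pauliSum ι k).PosSemidef := by
  have hc : (0 : ℝ) < Fintype.card ((ι → Fin 2) × (ι → Fin 2)) := by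
    exact_mod_cast Fintype.card_pos
  convert (Matrix.posSemidef_conjTranspose_mul_self (pauliSum ι k)).smul_real
    (inv_nonneg.2 hc.le) using 1
  rw [pauliSum_conjTranspose hk, pauliSum_mul_self hk, smul_smul, Complex.ofReal_inv,
    Complex.ofReal_natCast, inv_mul_cancel₀ (by exact_mod_cast hc.ne'), one_smul]

/-- Pauli strings are Hermitian or anti-Hermitian, so the trace is real or purely imaginary, and its
fourth power is that of its modulus. -/
theorem trace_pauliString_heisenberg_pow_four (U : Matrix.unitaryGroup (ι → Fin 2) ℂ)
    (u v u' v' : ι → Fin 2) :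
    (pauliString u v * heisenberg U (pauliString u' v')).trace ^ 4 =
      ((‖(pauliString u v * heisenberg U (pauliString u' v')).trace‖ ^ 4 : ℝ) : ℂ) := by
  set z := (pauliString u v * heisenberg U (pauliString u' v')).trace with hz
  have h : star z = (pauliSign u v * pauliSign u' v') * z := by
    rw [hz, ← Matrix.trace_conjTranspose, Matrix.conjTranspose_mul, heisenberg,
      Matrix.conjTranspose_mul, Matrix.conjTranspose_mul, Matrix.conjTranspose_conjTranspose,
      pauliString_conjTranspose, pauliString_conjTranspose, Matrix.trace_mul_comm]
    simp only [Matrix.smul_mul, Matrix.mul_smul, Matrix.trace_smul, smul_eq_mul, mul_assoc]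
    ring
  have h2 : (pauliSign u v * pauliSign u' v') ^ 2 = 1 := by
    rw [mul_pow, sq, sq, pauliSign_mul_self, pauliSign_mul_self, one_mul]
  have h3 : z * star z = ((‖z‖ ^ 2 : ℝ) : ℂ) := by
    rw [Complex.star_def, Complex.mul_conj, Complex.normSq_eq_norm_sq]
  calc z ^ 4 = (pauliSign u v * pauliSign u' v') ^ 2 * z ^ 4 := by rw [h2, one_mul]
    _ = (z * star z) ^ 2 := by rw [h]; ring
    _ = _ := by rw [h3, ← Complex.ofReal_pow, ← pow_mul]

theorem trace_pauliSum_mul_conjTensorPow (hk : 4 ≤ k)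
    (U : Matrix.unitaryGroup (ι → Fin 2) ℂ) :
    (pauliSum ι k * conjTensorPow k U (pauliSum ι k)).trace =
      ((((2 : ℝ) ^ Fintype.card ι) ^ (k - 4) * pauliFourthMoment U : ℝ) : ℂ) := by
  rw [pauliSum, conjTensorPow_sum, Finset.sum_mul, Matrix.trace_sum, pauliFourthMoment,
    Finset.mul_sum, Complex.ofReal_sum]
  refine Finset.sum_congr rfl fun w _ => ?_
  rw [Finset.mul_sum, Matrix.trace_sum, Finset.mul_sum, Complex.ofReal_sum]
  refine Finset.sum_congr rfl fun w' _ => ?_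
  have h := trace_pauliString_heisenberg_pow_four U w.1 w.2 w'.1 w'.2
  rw [heisenberg] at h
  rw [conjTensorPow_padFour, padFour_mul, trace_padFour hk, heisenberg, h, mul_comm]
  simp

theorem trace_pauliSum_four : (pauliSum ι 4).trace = ((2 : ℂ) ^ Fintype.card ι) ^ 4 := by
  rw [pauliSum, Matrix.trace_sum, Fintype.sum_eq_single 0]
  · rw [trace_padFour le_rfl, trace_pauliString]
    simp
  · intro w hw
    rw [trace_padFour le_rfl, trace_pauliString, if_neg fun h => hw (Prod.ext h.1 h.2)]
    simp

/-! ### Clifford invariance -/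

theorem isPauli_pauliString (u v : ι → Fin 2) : IsPauli (pauliString u v) :=
  ⟨1, u, v, one_pow 4, (one_smul _ _).symm⟩

theorem eq_of_smul_pauliString {c c' : ℂ} (hc : c ^ 4 = 1) {u v u' v' : ι → Fin 2}
    (h : c • pauliString u v = c' • pauliString u' v') : u = u' ∧ v = v' := by
  have h1 := congrArg (fun A => ((pauliString u v).conjTranspose * A).trace) h
  simp only [Matrix.mul_smul, Matrix.trace_smul,
    mul_eq_one_comm.1 (pauliString_mul_conjTranspose u v)] at h1
  rw [pauliString_conjTranspose, Matrix.smul_mul, pauliString_mul, Matrix.trace_smul,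
    Matrix.trace_smul, trace_pauliString] at h1
  have hc0 : c ≠ 0 := by
    rintro rfl
    simp at hc
  by_contra hne
  have hadd : ∀ x y : ι → Fin 2, x + y = 0 → x = y := fun x y hxy => by
    rw [← fin_two_add_self y] at hxy
    exact add_right_cancel hxy
  rw [if_neg fun h => hne ⟨hadd _ _ h.1, hadd _ _ h.2⟩] at h1
  simp [hc0] at h1

/-- Conjugation by `V` permutes the Pauli strings up to phases `c` with `c ^ 4 = 1`, which disappear
in the fourth tensor power. Injectivity suffices for a permutation, as there are finitely many
strings. -/
theorem IsClifford.conjTensorPow_pauliSum {V : Matrix.unitaryGroup (ι → Fin 2) ℂ}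
    (hV : IsClifford V) (hk : 4 ≤ k) : conjTensorPow k V (pauliSum ι k) = pauliSum ι k := by
  have hex : ∀ w : (ι → Fin 2) × (ι → Fin 2), ∃ w' : (ι → Fin 2) × (ι → Fin 2), ∃ c : ℂ,
      c ^ 4 = 1 ∧ heisenberg V (pauliString w.1 w.2) = c • pauliString w'.1 w'.2 := fun w => by
    obtain ⟨c, u, v, hc, h⟩ := hV _ (isPauli_pauliString w.1 w.2)
    exact ⟨(u, v), c, hc, h⟩
  choose φ c hc hφ using hex
  have hinv : ∀ M, (V : Matrix (ι → Fin 2) (ι → Fin 2) ℂ).conjTranspose * heisenberg V M *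
      (V : Matrix (ι → Fin 2) (ι → Fin 2) ℂ) = M := fun M => by
    rw [heisenberg, mul_assoc, mul_assoc, unitary_conjTranspose_mul, mul_one, ← mul_assoc,
      unitary_conjTranspose_mul, one_mul]
  have hinj : Function.Injective φ := by
    intro w w' hw
    have h1 : c w' • heisenberg V (pauliString w.1 w.2) =
        c w • heisenberg V (pauliString w'.1 w'.2) := by
      rw [hφ, hφ, hw, smul_smul, smul_smul, mul_comm]
    have h2 := congrArg (fun M => (V : Matrix (ι → Fin 2) (ι → Fin 2) ℂ).conjTranspose * M *
      (V : Matrix (ι → Fin 2) (ι → Fin 2) ℂ)) h1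
    simp only [Matrix.mul_smul, Matrix.smul_mul, hinv] at h2
    exact Prod.ext_iff.2 (eq_of_smul_pauliString (hc w') h2)
  rw [pauliSum, conjTensorPow_sum]
  refine (Finset.sum_congr rfl fun w _ => ?_).trans (Equiv.sum_comp
    (Equiv.ofBijective φ (Finite.injective_iff_bijective.1 hinj))
    fun w => padFour k (pauliString w.1 w.2))
  have h := hφ w
  rw [heisenberg] at h
  rw [conjTensorPow_padFour, h, padFour_smul hk, hc, one_smul]
  rfl

theorem pauliFourthMoment_clifford {V₁ V₂ : Matrix.unitaryGroup (ι → Fin 2) ℂ}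
    (h₁ : IsClifford V₁) (h₂ : IsClifford V₂) (U : Matrix.unitaryGroup (ι → Fin 2) ℂ) :
    pauliFourthMoment (V₁ * U * V₂) = pauliFourthMoment U := by
  have h := trace_mul_conjTensorPow_of_invariant (h₁.conjTensorPow_pauliSum (k := 4) le_rfl)
    (h₂.conjTensorPow_pauliSum le_rfl) U
  rw [trace_pauliSum_mul_conjTensorPow le_rfl, trace_pauliSum_mul_conjTensorPow le_rfl] at h
  simpa using h

end PauliSum

/-! ### Haar averages -/

section HaarAverage

variable {k : ℕ} {n : Type*} [Fintype n] [DecidableEq n]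

/-- Choose a phase `c` with `c tr(AQ) = |tr(AQ)|`. Then `0 ≤ tr((1 - cQ)† A (1 - cQ)) = 2 tr A - 2
|tr(AQ)|`. -/
theorem norm_trace_mul_unitary_le {m : Type*} [Fintype m] [DecidableEq m] {A Q : Matrix m m ℂ}
    (hA : A.PosSemidef) (hQ : Q * Q.conjTranspose = 1) : ‖(A * Q).trace‖ ≤ A.trace.re := by
  obtain ⟨c, hc, hcz⟩ : ∃ c : ℂ, c * star c = 1 ∧ c * (A * Q).trace = ‖(A * Q).trace‖ := by
    rcases eq_or_ne (A * Q).trace 0 with h | h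
    · exact ⟨1, by simp, by simp [h]⟩
    · have hn : (‖(A * Q).trace‖ : ℂ) ≠ 0 := by simpa using h
      have hm : star (A * Q).trace * (A * Q).trace = (‖(A * Q).trace‖ : ℂ) ^ 2 := by
        rw [Complex.star_def, mul_comm, Complex.mul_conj, Complex.normSq_eq_norm_sq]
        push_cast
        rfl
      refine ⟨star (A * Q).trace / ‖(A * Q).trace‖, ?_, ?_⟩
      · have hs : star (‖(A * Q).trace‖ : ℂ) = ‖(A * Q).trace‖ := Complex.conj_ofReal _
        rw [star_div₀, star_star, hs, div_mul_div_comm, hm, ← sq, div_self (pow_ne_zero 2 hn)]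
      · rw [div_mul_eq_mul_div, hm]
        field_simp
  have h1 := (hA.conjTranspose_mul_mul_same (1 - c • Q)).trace_nonneg
  have h2 : ((1 - c • Q).conjTranspose * A * (1 - c • Q)).trace =
      2 * A.trace - ‖(A * Q).trace‖ - star (‖(A * Q).trace‖ : ℂ) := by
    have hadj : (Q.conjTranspose * A).trace = star (A * Q).trace := by
      rw [← Matrix.trace_conjTranspose, Matrix.conjTranspose_mul, hA.1.eq]
    have hexp : (1 - c • Q) * (1 - c • Q).conjTranspose =
        (2 : ℂ) • 1 - c • Q - star c • Q.conjTranspose := by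
      rw [Matrix.conjTranspose_sub, Matrix.conjTranspose_one, Matrix.conjTranspose_smul, sub_mul,
        mul_sub, mul_sub, mul_one, one_mul, mul_one, smul_mul_smul_comm, hQ, hc]
      module
    rw [Matrix.trace_mul_cycle, hexp, ← hcz, star_mul', ← hadj]
    simp only [sub_mul, Matrix.smul_mul, one_mul, Matrix.trace_sub, Matrix.trace_smul, smul_eq_mul,
      Matrix.trace_mul_comm Q A]
  rw [h2, Complex.nonneg_iff] at h1
  have := h1.1
  simp at this
  linarith

open scoped MatrixOrder in
theorem Matrix.PosSemidef.trace_mul_nonneg {m : Type*} [Fintype m] [DecidableEq m]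
    {A B : Matrix m m ℂ} (hA : A.PosSemidef) (hB : B.PosSemidef) : 0 ≤ (A * B).trace := by
  obtain ⟨C, rfl⟩ := CStarAlgebra.nonneg_iff_eq_star_mul_self.mp hA.nonneg
  rw [mul_assoc, Matrix.trace_mul_comm, mul_assoc, ← mul_assoc]
  exact (hB.mul_mul_conjTranspose_same C).trace_nonneg

/-- The scalar `∏ (D - i)` is below `∑ π, tr(π) π`, which commutes with the twirl. Replacing it
leaves `∑ π, tr(A π⁻¹) tr(A π)`, that is, `k!` terms each at most `(tr A)²` in modulus. -/
theorem trace_mul_twirl_haarUnitary_le (hk : k ≤ Fintype.card n)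
    {A : Matrix (Fin k → n) (Fin k → n) ℂ} (hA : A.PosSemidef) :
    (∏ i ∈ Finset.range k, ((Fintype.card n : ℝ) - i)) *
      (A * twirl (haarUnitary n) k A).trace.re ≤ k.factorial * A.trace.re ^ 2 := by
  set B := twirl (haarUnitary n) k A with hB
  set c := ∏ i ∈ Finset.range k, ((Fintype.card n : ℝ) - i)
  have hBp : B.PosSemidef := twirl_posSemidef _ hA
  have hWB : traceWeighted n (permMat n) * B =
    ∑ π, (A * permMat n π⁻¹).trace • permMat n π := traceWeighted_mul_twirl A
  have hstar : ∀ π : Equiv.Perm (Fin k), star (A * permMat n π).trace =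
      (A * permMat n π⁻¹).trace := fun π => by
    rw [← Matrix.trace_conjTranspose, Matrix.conjTranspose_mul, hA.1.eq, permMat_conjTranspose,
      Matrix.trace_mul_comm]
  have hcomm : Commute (traceWeighted n (permMat n (k := k))) B := by
    refine Matrix.IsHermitian.commute_of_mul (traceWeighted_isHermitian permMat_conjTranspose)
      hBp.1 ?_
    rw [hWB, Matrix.IsHermitian, Matrix.conjTranspose_sum,
      ← Equiv.sum_comp (Equiv.inv (Equiv.Perm (Fin k)))]
    refine Finset.sum_congr rfl fun π _ => ?_
    rw [Equiv.inv_apply, Matrix.conjTranspose_smul, hstar, permMat_conjTranspose]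
    simp only [inv_inv]
  have hpos := (spectrumBetween_traceWeighted hk (permMat_conjTranspose (n := n))).1.mul_of_commute
    hBp (hcomm.sub_left ((Commute.one_left B).smul_left _))
  have h1 := (Complex.nonneg_iff.1 (hA.trace_mul_nonneg hpos)).1
  rw [sub_mul, hWB, Matrix.smul_mul, one_mul, mul_sub, Matrix.trace_sub, Matrix.mul_smul,
    Matrix.trace_smul, smul_eq_mul, Complex.sub_re, Complex.re_ofReal_mul, sub_nonneg] at h1
  refine h1.trans ?_
  rw [Finset.mul_sum, Matrix.trace_sum]
  refine (Complex.re_le_norm _).trans ((norm_sum_le _ _).trans ?_)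
  have hQ : ∀ π : Equiv.Perm (Fin k), ‖(A * permMat n π).trace‖ ≤ A.trace.re := fun π =>
    norm_trace_mul_unitary_le hA (by
      rw [permMat_conjTranspose, ← map_mul, mul_inv_cancel, map_one])
  refine (Finset.sum_le_card_nsmul _ _ (A.trace.re ^ 2) fun π _ => ?_).trans_eq ?_
  · rw [Matrix.mul_smul, Matrix.trace_smul, norm_smul, sq]
    exact mul_le_mul (hQ _) (hQ _) (norm_nonneg _) ((norm_nonneg _).trans (hQ π))
  · rw [Finset.card_univ, Fintype.card_perm, Fintype.card_fin, nsmul_eq_mul]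

end HaarAverage

/-! ### The no-go theorem -/

section NoGo

variable {ι : Type*} [Fintype ι] [DecidableEq ι]

theorem continuous_pauliFourthMoment :
    Continuous (pauliFourthMoment : Matrix.unitaryGroup (ι → Fin 2) ℂ → ℝ) := by
  have h : (pauliFourthMoment : Matrix.unitaryGroup (ι → Fin 2) ℂ → ℝ) =
      fun U => (pauliSum ι 4 * conjTensorPow 4 U (pauliSum ι 4)).trace.re := by
    ext U
    rw [trace_pauliSum_mul_conjTensorPow le_rfl, Complex.ofReal_re]
    simp
  rw [h]
  exact Complex.continuous_re.comp
    (continuous_const.matrix_mul (continuous_conjTensorPow 4 _)).matrix_trace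

theorem integrable_pauliFourthMoment (μ : Measure (Matrix.unitaryGroup (ι → Fin 2) ℂ))
    [IsFiniteMeasure μ] : Integrable pauliFourthMoment μ :=
  continuous_pauliFourthMoment.integrable_of_hasCompactSupport
    (HasCompactSupport.of_compactSpace _)

theorem trace_pauliSum_mul_twirl {k : ℕ} (hk : 4 ≤ k)
    (μ : Measure (Matrix.unitaryGroup (ι → Fin 2) ℂ)) [IsFiniteMeasure μ] :
    (pauliSum ι k * twirl μ k (pauliSum ι k)).trace =
      ((((2 : ℝ) ^ Fintype.card ι) ^ (k - 4) * ∫ U, pauliFourthMoment U ∂μ : ℝ) : ℂ) := by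
  rw [trace_mul_twirl]
  simp only [trace_pauliSum_mul_conjTensorPow hk]
  rw [integral_complex_ofReal, integral_const_mul]

/-- Pair the upper design condition, evaluated at the positive operator `pauliSum`, with `pauliSum`
itself. The padding contributes the same power of the dimension to both sides, so no reduction from
`k` to `4` is needed. -/
theorem IsRelativeUnitaryDesign.integral_pauliFourthMoment_le {k : ℕ} (hk : 4 ≤ k) {ε : ℝ}
    {μ : Measure (Matrix.unitaryGroup (ι → Fin 2) ℂ)} [IsFiniteMeasure μ]
    (h : IsRelativeUnitaryDesign μ k ε) :
    ∫ U, pauliFourthMoment U ∂μ ≤ (1 + ε) * ∫ U, pauliFourthMoment U ∂haarUnitary (ι → Fin 2) := by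
  have hA := pauliSum_posSemidef (ι := ι) hk
  have h1 := hA.trace_mul_nonneg (h.2.posSemidef_apply hA)
  rw [LinearMap.sub_apply, LinearMap.smul_apply, mul_sub, Matrix.mul_smul, Matrix.trace_sub,
    Matrix.trace_smul, trace_pauliSum_mul_twirl hk, trace_pauliSum_mul_twirl hk, smul_eq_mul,
    ← Complex.ofReal_mul, ← Complex.ofReal_sub, Complex.zero_le_real, sub_nonneg,
    mul_left_comm] at h1
  exact le_of_mul_le_mul_left h1 (by positivity)

theorem integral_haarUnitary_pauliFourthMoment_le (hι : 3 ≤ Fintype.card ι) :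
    ∫ U, pauliFourthMoment U ∂haarUnitary (ι → Fin 2) ≤ 96 * ((2 : ℝ) ^ Fintype.card ι) ^ 4 := by
  have hcard : ((Fintype.card (ι → Fin 2) : ℕ) : ℝ) = 2 ^ Fintype.card ι := by simp
  have hD : (8 : ℝ) ≤ 2 ^ Fintype.card ι := by
    calc (8 : ℝ) = 2 ^ 3 := by norm_num
      _ ≤ _ := pow_le_pow_right₀ (by norm_num) hι
  have h := trace_mul_twirl_haarUnitary_le (n := ι → Fin 2) (k := 4)
    (by
      have : (8 : ℝ) ≤ (Fintype.card (ι → Fin 2) : ℕ) := by rw [hcard]; exact hD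
      have : 8 ≤ Fintype.card (ι → Fin 2) := by exact_mod_cast this
      omega)
    (pauliSum_posSemidef le_rfl)
  have htr : (pauliSum ι 4).trace.re = ((2 : ℝ) ^ Fintype.card ι) ^ 4 := by
    rw [trace_pauliSum_four]
    exact_mod_cast Complex.ofReal_re (((2 : ℝ) ^ Fintype.card ι) ^ 4)
  rw [trace_pauliSum_mul_twirl le_rfl, Complex.ofReal_re, htr, hcard, Nat.sub_self, pow_zero,
    one_mul] at h
  have hI : 0 ≤ ∫ U, pauliFourthMoment U ∂haarUnitary (ι → Fin 2) :=
    integral_nonneg fun U => Finset.sum_nonneg fun _ _ => Finset.sum_nonneg fun _ _ => by positivity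
  generalize ∫ U, pauliFourthMoment U ∂haarUnitary (ι → Fin 2) = I at h hI ⊢
  generalize (2 : ℝ) ^ Fintype.card ι = D at h hD ⊢
  -- For `D ≥ 8` the falling product loses at most a factor `4`; with `4! = 24` this gives the
  -- constant `96`.
  have hprod : D ^ 4 / 4 ≤ ∏ i ∈ Finset.range 4, (D - i) := by
    simp only [Finset.prod_range_succ, Finset.prod_range_zero, one_mul]
    push_cast
    have h1 : D * D * (3 / 4) ≤ (D - 0) * (D - 1) := by nlinarith
    have h2 : D * D * (1 / 3) ≤ (D - 2) * (D - 3) := by nlinarith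
    have h3 := mul_le_mul h1 h2 (by positivity) (by nlinarith)
    calc D ^ 4 / 4 = D * D * (3 / 4) * (D * D * (1 / 3)) := by ring
      _ ≤ _ := h3
      _ = _ := by ring
  have h2 := (mul_le_mul_of_nonneg_right hprod hI).trans h
  have h3 : (Nat.factorial 4 : ℝ) = 24 := by norm_num [Nat.factorial]
  rw [h3] at h2
  refine le_of_mul_le_mul_left (a := D ^ 4 / 4) (h2.trans_eq ?_) (by positivity)
  ring

theorem IsRelativeUnitaryDesign.le_of_isCliffordSandwich {d L t k : ℕ} {ε : ℝ}
    {μ : Measure (Matrix.unitaryGroup ((Fin d → Fin L) → Fin 2) ℂ)} [IsProbabilityMeasure μ]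
    (hL : 3 ≤ L ^ d) (hk : 4 ≤ k) (hε : 0 ≤ ε) (hμ : ∀ᵐ W ∂μ, IsCliffordSandwich t W)
    (h : IsRelativeUnitaryDesign μ k ε) :
    (L : ℝ) ^ d ≤ 96 * (1 + ε) * 4 ^ ((2 * t + 1) ^ d) := by
  have hcard : Fintype.card (Fin d → Fin L) = L ^ d := by simp
  have h1 := h.integral_pauliFourthMoment_le hk
  have h2 := integral_haarUnitary_pauliFourthMoment_le (ι := Fin d → Fin L) (by rwa [hcard])
  rw [hcard] at h2
  have h3 : ((2 : ℝ) ^ (L ^ d)) ^ 4 * (L : ℝ) ^ d / (4 : ℝ) ^ ((2 * t + 1) ^ d) ≤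
      ∫ U, pauliFourthMoment U ∂μ := by
    have h4 : ∀ᵐ W ∂μ, ((2 : ℝ) ^ (L ^ d)) ^ 4 * (L : ℝ) ^ d / (4 : ℝ) ^ ((2 * t + 1) ^ d) ≤
        pauliFourthMoment W := hμ.mono fun W hW => by
      obtain ⟨V₁, U, V₂, hV₁, hV₂, hU, rfl⟩ := hW
      rw [pauliFourthMoment_clifford hV₁ hV₂, div_le_iff₀' (by positivity)]
      exact hU.pauliFourthMoment_ge
    have h5 := integral_mono_ae (integrable_const _) (integrable_pauliFourthMoment μ) h4
    simpa using h5
  have h6 := (h3.trans h1).trans (mul_le_mul_of_nonneg_left h2 (by linarith))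
  rw [div_le_iff₀ (by positivity)] at h6
  refine le_of_mul_le_mul_left (a := ((2 : ℝ) ^ (L ^ d)) ^ 4) (h6.trans_eq ?_) (by positivity)
  ring

end NoGo

/-! ### Asymptotics of the depth bound -/

section Asymptotics

/-- A depth `o((log y)^{1/d})` has light cones of size at most `δ log y`. -/
theorem eventually_lightCone_le {d : ℕ} (hd : 1 ≤ d) {t : ℕ → ℕ} {y : ℕ → ℝ}
    (hy : Tendsto y atTop atTop)
    (ht : (fun n => (t n : ℝ)) =o[atTop] fun n => Real.log (y n) ^ (1 / (d : ℝ)))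
    {δ : ℝ} (hδ : 0 < δ) (hδ1 : δ ≤ 1) :
    ∀ᶠ n in atTop, ((2 * (t n : ℝ) + 1) ^ d) ≤ δ * Real.log (y n) := by
  have hlog : Tendsto (fun n => Real.log (y n)) atTop atTop := Real.tendsto_log_atTop.comp hy
  have hd0 : (0 : ℝ) < d := by exact_mod_cast hd
  have hroot : Tendsto (fun n => Real.log (y n) ^ (1 / (d : ℝ))) atTop atTop :=
    (tendsto_rpow_atTop (by positivity)).comp hlog
  -- With `r = (log y)^{1/d}`, eventually `t ≤ (δ/3) r` and `1 ≤ (δ/3) r`, hence `2t + 1 ≤ δ r`.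
  filter_upwards [ht.bound (show (0 : ℝ) < δ / 3 by positivity), hlog.eventually_ge_atTop 0,
    hroot.eventually_ge_atTop (3 / δ)] with n h1 h2 h3
  set r := Real.log (y n) ^ (1 / (d : ℝ)) with hr
  have hr0 : 0 ≤ r := Real.rpow_nonneg h2 _
  have hrd : r ^ d = Real.log (y n) := by
    rw [hr, ← Real.rpow_natCast, ← Real.rpow_mul h2, one_div_mul_cancel hd0.ne', Real.rpow_one]
  rw [Real.norm_of_nonneg (Nat.cast_nonneg _), Real.norm_of_nonneg hr0] at h1
  have h4 : 1 ≤ δ / 3 * r := by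
    rw [div_le_iff₀ hδ] at h3
    linarith
  calc (2 * (t n : ℝ) + 1) ^ d ≤ (δ * r) ^ d :=
        pow_le_pow_left₀ (by positivity) (by linarith) d
    _ = δ ^ d * Real.log (y n) := by rw [mul_pow, hrd]
    _ ≤ δ * Real.log (y n) :=
      mul_le_mul_of_nonneg_right (pow_le_of_le_one hδ.le hδ1 (by omega)) h2

theorem eventually_lightCone_bound_lt {d : ℕ} (hd : 1 ≤ d) {L t : ℕ → ℕ} {ε : ℕ → ℝ} {C : ℝ}
    (hε : ∀ n, 0 < ε n)
    (hy : Tendsto (fun n => ((L n : ℝ) ^ d) / ε n) atTop atTop)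
    (hC : ∀ᶠ n in atTop, ((L n : ℝ) ^ d) ^ (-C) ≤ ε n)
    (ht : (fun n => (t n : ℝ)) =o[atTop]
      fun n => (Real.log (((L n : ℝ) ^ d) / ε n)) ^ (1 / (d : ℝ)))
    (K : ℝ) (hK : 0 < K) :
    ∀ᶠ n in atTop, 3 ≤ L n ^ d ∧ K * (1 + ε n) * 4 ^ ((2 * t n + 1) ^ d) < (L n : ℝ) ^ d := by
  -- For `y = N/ε`, the lower bound on `ε` gives `y ≤ N^b`. With `η = 1/(2b)`, the square of `y^η`
  -- is then at most both `N` and `y`.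
  set b : ℝ := max (1 + C) 1 with hb
  have hb1 : 1 ≤ b := le_max_right _ _
  have hb0 : 0 < b := by linarith
  set η : ℝ := 1 / (2 * b) with hη
  have hη0 : 0 < η := by positivity
  have hη1 : η ≤ 1 / 2 := by
    rw [hη]
    exact one_div_le_one_div_of_le (by norm_num) (by linarith)
  have hlog4 : 1 ≤ Real.log 4 := by
    rw [Real.le_log_iff_exp_le (by norm_num)]
    linarith [Real.exp_one_lt_d9]
  -- This `δ` is chosen to give `4^{(2t+1)^d} ≤ y^η`.
  have hlc := eventually_lightCone_le hd hy ht (δ := η / Real.log 4) (by positivity)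
    ((div_le_one (by linarith)).2 (by linarith))
  have hpow : Tendsto (fun n => (((L n : ℝ) ^ d) / ε n) ^ η) atTop atTop :=
    (tendsto_rpow_atTop hη0).comp hy
  filter_upwards [hlc, hC, hy.eventually_ge_atTop 1, hpow.eventually_gt_atTop (2 * K),
    hpow.eventually_ge_atTop 3] with n h1 h2 h3 h4 h5
  have hε' := hε n
  set N : ℝ := (L n : ℝ) ^ d with hN
  set y : ℝ := N / ε n with hy'
  have hyN : N = y * ε n := by rw [hy', div_mul_cancel₀ _ hε'.ne']
  have hy0 : 0 < y := by linarith
  have hN0 : 0 < N := by rw [hyN]; positivity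
  have hN1 : 1 ≤ N := by
    have : (1 : ℕ) ≤ L n ^ d := by
      have : (0 : ℝ) < ((L n ^ d : ℕ) : ℝ) := by push_cast; exact hN0
      exact_mod_cast this
    rw [hN]
    exact_mod_cast this
  have hyb : y ≤ N ^ b := by
    calc y ≤ N / N ^ (-C) := div_le_div_of_nonneg_left hN0.le (by positivity) h2
      _ = N ^ (1 + C) := by
        rw [Real.rpow_neg hN0.le, div_inv_eq_mul, Real.rpow_add hN0, Real.rpow_one]
      _ ≤ N ^ b := Real.rpow_le_rpow_of_exponent_le hN1 (le_max_left _ _)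
  have hyη : y ^ η * y ^ η ≤ N := by
    rw [← Real.rpow_add hy0]
    calc y ^ (η + η) ≤ (N ^ b) ^ (η + η) := Real.rpow_le_rpow hy0.le hyb (by linarith)
      _ = N := by
        rw [← Real.rpow_mul hN0.le, hη, show b * (1 / (2 * b) + 1 / (2 * b)) = 1 by
          field_simp; norm_num, Real.rpow_one]
  have hyη' : y ^ η * y ^ η ≤ y := by
    rw [← Real.rpow_add hy0]
    calc y ^ (η + η) ≤ y ^ (1 : ℝ) := Real.rpow_le_rpow_of_exponent_le h3 (by linarith)
      _ = y := Real.rpow_one y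
  have h4pow : (4 : ℝ) ^ ((2 * t n + 1) ^ d) ≤ y ^ η := by
    rw [← Real.rpow_natCast, Real.rpow_def_of_pos (by norm_num), Real.rpow_def_of_pos hy0,
      Real.exp_le_exp]
    push_cast
    rw [div_mul_eq_mul_div, le_div_iff₀ (by linarith)] at h1
    linarith
  constructor
  · have : (3 : ℝ) ≤ N := by nlinarith
    rw [hN] at this
    exact_mod_cast this
  · refine (mul_le_mul_of_nonneg_left h4pow (by positivity)).trans_lt ?_
    have hz : 0 < y ^ η := by positivity
    -- For `ε ≤ 1`, use `2K y^η < y^{2η} ≤ N`. For `ε ≥ 1`, use `2K ε y^η < ε y^{2η} ≤ ε y = N`.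
    rcases le_total (ε n) 1 with h | h
    · nlinarith [mul_pos hK hz]
    · have : N = y * ε n := hyN
      have h6 : K * (1 + ε n) * y ^ η ≤ 2 * K * y ^ η * ε n := by nlinarith [mul_pos hK hz]
      have h7 : 2 * K * y ^ η < y := by nlinarith
      nlinarith

end Asymptotics

end

/-! ### The main theorem -/

theorem mainTheorem11 :
    -- Choi states of a relative-error unitary design form a relative-error state design
    (∀ (N k : ℕ) (ε' : ℝ) (μ : Measure (Matrix.unitaryGroup (Fin N → Fin 2) ℂ))
        [IsProbabilityMeasure μ],
      k ^ 2 ≤ 2 ^ N → IsRelativeUnitaryDesign μ k ε' →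
      IsRelativeStateDesign μ choiState k
        ((1 + ε') * (1 + (k : ℝ) ^ 2 / 2 ^ N) * (1 + (k : ℝ) ^ 2 / 2 ^ (2 * N)) - 1)) ∧
    -- no-go theorem for Clifford-sandwiched local circuits on `N = L ^ d` qubits
    (∀ (d : ℕ) (L t : ℕ → ℕ) (ε : ℕ → ℝ) (C : ℝ),
      1 ≤ d → (∀ n, 0 < ε n) →
      Tendsto (fun n => ((L n : ℝ) ^ d) / ε n) atTop atTop →
      (∀ᶠ n in atTop, ((L n : ℝ) ^ d) ^ (-C) ≤ ε n) →
      (fun n => (t n : ℝ)) =o[atTop]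
        (fun n => (Real.log (((L n : ℝ) ^ d) / ε n)) ^ (1 / (d : ℝ))) →
      ∀ᶠ n in atTop, ∀ (k : ℕ)
        (μ : Measure (Matrix.unitaryGroup ((Fin d → Fin (L n)) → Fin 2) ℂ))
        [IsProbabilityMeasure μ],
        4 ≤ k → (∀ᵐ W ∂μ, IsCliffordSandwich (t n) W) →
        ¬ IsRelativeUnitaryDesign μ k (ε n)) := by
  refine ⟨fun N k ε' μ _ hk h => ?_, fun d L t ε C hd hε hy hC ht => ?_⟩
  · have hcard : Fintype.card (Fin N → Fin 2) = 2 ^ N := by simp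
    have := h.isRelativeStateDesign_choiState (by rwa [hcard])
    rw [hcard] at this
    push_cast at this
    rwa [← pow_mul, mul_comm N 2] at this
  · filter_upwards [eventually_lightCone_bound_lt hd hε hy hC ht 96 (by norm_num)]
      with n hn k μ _ hk hμ h
    exact absurd (h.le_of_isCliffordSandwich hn.1 hk (hε n).le hμ) (not_le.2 hn.2)
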